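/- Let $n\ge 2$, let $A_n$ be an alphabet with $n$ letters, $A_n^{*}$ the free monoid of finite words over $A_n$ (with $|x|$ the length of $x$), and $A_n^{\omega}$ the Cantor space of right-infinite words, whose open sets are the sets $XA_n^{\omega}$ with $X\subseteq A_n^{*}$. **The Cuntz inverse monoid.** A finitely generated right ideal of $A_n^{*}$ is a set $XA_n^{*}$ with $X\subseteq A_n^{*}$ finite. Let $D_n$ be the set of all bijections $\theta\colon R_1\to R_2$ between finitely generated right ideals such that $\theta(rs)=\theta(r)s$ for all $r\in R_1$, $s\in A_n^{*}$. Under composition of partial functions $D_n$ is an inverse monoid whose zero is the empty function. In any inverse semigroup write $a\le b$ if $a=ba^{-1}a$. On an inverse semigroup with zero, the Lenz congruence is defined by $s\equiv t$ if and only if for every $0<x\le s$ there is $z\ne 0$ with $z\le x$ and $z\le t$, and for every $0<y\le t$ there is $z\neq 0$ with $z\le y$ and $z\le s$. Put $C_n=D_n/{\equiv}$, an inverse monoid with zero. **The groupoid of ultrafilters.** Let $S$ be an inverse semigroup with zero. For $X\subseteq S$ put $X^{\uparrow}=\{s\in S: x\le s\text{ for some }x\in X\}$. A filter is a non-empty set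 $A\subseteq S$ with $A=A^{\uparrow}$ such that any $a,b\in A$ have a common lower bound $c\in A$. It is proper if $0\notin A$, and an ultrafilter is a maximal proper filter. Let $\mathsf G(S)$ be the set of ultrafilters of $S$; for $A\in\mathsf G(S)$ put $\mathbf d(A)=(A^{-1}A)^{\uparrow}$ and $\mathbf r(A)=(AA^{-1})^{\uparrow}$. When $\mathbf d(A)=\mathbf r(B)$, put $A\cdot B=(AB)^{\uparrow}$. This makes $\mathsf G(S)$ a groupoid, with the inverse of $A$ being $A^{-1}$. Give it the topology with base the sets $V_s=\{A\in\mathsf G(S): s\in A\}$, $s\in S$. **The Cuntz groupoid.** Let $\mathcal G_n$ be the set of all triples $(xw,|x|-|y|,yw)\in A_n^{\omega}\times\mathbb Z\times A_n^{\omega}$ with $x,y\in A_n^{*}$ and $w\in A_n^{\omega}$. It is a groupoid under the partial product $(z,k,z')(z',k',z'')=(z,k+k',z'')$, with $(z,k,z')^{-1}=(z',-k,z)$. Its topology has as base the sets $U_{x,y,V}=\{(xw,|x|-|y|,yw): w\in V\}$ with $x,y\in A_n^{*}$ and $V\subseteq A_n^{\omega}$ open. **Theorem.** The groupoid $\mathsf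 G(C_n)$ is an étale topological groupoid (inversion and composition are continuous, and $\mathbf d$ is a local homeomorphism onto the space of identities). It is isomorphic to $\mathcal G_n$ as a topological groupoid: there is a homeomorphism $\mathsf G(C_n)\to\mathcal G_n$ that preserves and reflects composability and preserves products. -/

import Mathlib

namespace CuntzGroupoid

/-! ### Inverse monoids with zero -/

/-- An inverse monoid with zero: every element `a` has a unique inverse `a⁻¹`, that is, a unique
element with `a a⁻¹ a = a` and `a⁻¹ a a⁻¹ = a⁻¹`. -/
class InverseMonoidWithZero (S : Type*) extends MonoidWithZero S, Inv S where
  mul_inv_mul : ∀ a : S, a * a⁻¹ * a = a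
  inv_mul_inv : ∀ a : S, a⁻¹ * a * a⁻¹ = a⁻¹
  inv_unique : ∀ a b : S, a * b * a = a → b * a * b = b → b = a⁻¹

/-- Uniqueness of inverses from the equational axioms of inverse semigroups. -/
theorem inv_unique_of_identities {S : Type*} [Monoid S] [Inv S]
    (h1 : ∀ a : S, a * a⁻¹ * a = a) (h2 : ∀ a : S, (a⁻¹)⁻¹ = a)
    (h3 : ∀ a b : S, (a * b)⁻¹ = b⁻¹ * a⁻¹)
    (h4 : ∀ a b : S, a * a⁻¹ * (b * b⁻¹) = b * b⁻¹ * (a * a⁻¹))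
    (a b : S) (hab : a * b * a = a) (hba : b * a * b = b) : b = a⁻¹ := by
  have h1' : ∀ a : S, a⁻¹ * a * a⁻¹ = a⁻¹ := fun a => by simpa [h2] using h1 a⁻¹
  have hidem : ∀ e : S, e * e = e → e * e⁻¹ = e := by
    intro e he
    have he' : e⁻¹ * e⁻¹ = e⁻¹ := by rw [← h3, he]
    have key : e⁻¹ = e := by
      have h := h4 e⁻¹ e
      rw [h2] at h
      have l : e⁻¹ * e * (e * e⁻¹) = e⁻¹ := by
        rw [mul_assoc, ← mul_assoc e e, he, ← mul_assoc, h1']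
      have r : e * e⁻¹ * (e⁻¹ * e) = e := by
        rw [mul_assoc, ← mul_assoc e⁻¹ e⁻¹, he', ← mul_assoc, h1]
      rw [← l, h, r]
    rw [key, he]
  have hcomm : ∀ e f : S, e * e = e → f * f = f → e * f = f * e := by
    intro e f he hf
    have := h4 e f
    rwa [hidem e he, hidem f hf] at this
  have e1 : a * b * (a * b) = a * b := by rw [← mul_assoc, hab]
  have e2 : a * a⁻¹ * (a * a⁻¹) = a * a⁻¹ := by rw [← mul_assoc, h1]
  have e3 : b * a * (b * a) = b * a := by rw [← mul_assoc, hba]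
  have e4 : a⁻¹ * a * (a⁻¹ * a) = a⁻¹ * a := by rw [← mul_assoc, h1']
  have k1 : a * b = a * a⁻¹ := by
    calc a * b = (a * a⁻¹) * (a * b) := by rw [← mul_assoc, h1]
      _ = (a * b) * (a * a⁻¹) := hcomm _ _ e2 e1
      _ = a * a⁻¹ := by rw [← mul_assoc, hab]
  have k2 : b * a = a⁻¹ * a := by
    calc b * a = (b * a) * (a⁻¹ * a) := by rw [mul_assoc, ← mul_assoc a, h1]
      _ = (a⁻¹ * a) * (b * a) := hcomm _ _ e3 e4
      _ = a⁻¹ * a := by rw [mul_assoc, ← mul_assoc a, hab]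
  calc b = b * a * b := hba.symm
    _ = a⁻¹ * a * b := by rw [k2]
    _ = a⁻¹ * (a * a⁻¹) := by rw [mul_assoc, k1]
    _ = a⁻¹ := by rw [← mul_assoc, h1']

section InverseMonoid

variable {S : Type*} [InverseMonoidWithZero S]

open InverseMonoidWithZero (mul_inv_mul inv_mul_inv)

/-- The natural partial order: `a ≤ b` if and only if `a = b a⁻¹ a`. -/
def NatLE (a b : S) : Prop := a = b * a⁻¹ * a

theorem inv_inv_eq (a : S) : (a⁻¹)⁻¹ = a :=
  (InverseMonoidWithZero.inv_unique a⁻¹ a (inv_mul_inv a) (mul_inv_mul a)).symm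

theorem inv_of_idem {e : S} (he : e * e = e) : e⁻¹ = e :=
  (InverseMonoidWithZero.inv_unique e e (by rw [he, he]) (by rw [he, he])).symm

theorem idem_mul_idem {e f : S} (he : e * e = e) (hf : f * f = f) :
    e * f * (e * f) = e * f := by
  set x := (e * f)⁻¹ with hx
  have p1 : e * f * x * (e * f) = e * f := mul_inv_mul _
  have p2 : x * (e * f) * x = x := inv_mul_inv _
  have hxe : f * x * e = x := by
    apply InverseMonoidWithZero.inv_unique
    · calc e * f * (f * x * e) * (e * f) = e * (f * f) * x * (e * e) * f := by
            simp only [mul_assoc]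
        _ = e * f * x * (e * f) := by rw [he, hf]; simp only [mul_assoc]
        _ = e * f := p1
    · calc f * x * e * (e * f) * (f * x * e) = f * x * (e * e) * (f * f) * x * e := by
            simp only [mul_assoc]
        _ = f * (x * (e * f) * x) * e := by rw [he, hf]; simp only [mul_assoc]
        _ = f * x * e := by rw [p2]
  have hxx : x * x = x := by
    calc x * x = f * x * e * (f * x * e) := by rw [hxe]
      _ = f * (x * (e * f) * x) * e := by simp only [mul_assoc]
      _ = x := by rw [p2, hxe]
  have : e * f = x := by rw [← inv_inv_eq (e * f), ← hx, inv_of_idem hxx]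
  rw [this, hxx]

theorem idem_comm {e f : S} (he : e * e = e) (hf : f * f = f) : e * f = f * e := by
  have h1 := idem_mul_idem he hf
  have h2 := idem_mul_idem hf he
  have : f * e = (e * f)⁻¹ := by
    apply InverseMonoidWithZero.inv_unique
    · calc e * f * (f * e) * (e * f) = e * (f * f) * (e * e) * f := by simp only [mul_assoc]
        _ = e * f := by rw [he, hf]; simpa only [mul_assoc] using h1
    · calc f * e * (e * f) * (f * e) = f * (e * e) * (f * f) * e := by simp only [mul_assoc]
        _ = f * e := by rw [he, hf]; simpa only [mul_assoc] using h2
  rw [this, inv_of_idem h1]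

theorem inv_mul_idem (a : S) : a⁻¹ * a * (a⁻¹ * a) = a⁻¹ * a := by
  rw [← mul_assoc, inv_mul_inv]

theorem mul_inv_idem (a : S) : a * a⁻¹ * (a * a⁻¹) = a * a⁻¹ := by
  rw [← mul_assoc, mul_inv_mul]

theorem inv_mul_rev (a b : S) : (a * b)⁻¹ = b⁻¹ * a⁻¹ := by
  symm
  have hc := idem_comm (mul_inv_idem b) (inv_mul_idem a)
  apply InverseMonoidWithZero.inv_unique
  · calc a * b * (b⁻¹ * a⁻¹) * (a * b) = a * ((b * b⁻¹) * (a⁻¹ * a)) * b := by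
          simp only [mul_assoc]
      _ = (a * a⁻¹ * a) * (b * b⁻¹ * b) := by rw [hc]; simp only [mul_assoc]
      _ = a * b := by rw [mul_inv_mul, mul_inv_mul]
  · calc b⁻¹ * a⁻¹ * (a * b) * (b⁻¹ * a⁻¹) = b⁻¹ * ((a⁻¹ * a) * (b * b⁻¹)) * a⁻¹ := by
          simp only [mul_assoc]
      _ = (b⁻¹ * b * b⁻¹) * (a⁻¹ * a * a⁻¹) := by rw [← hc]; simp only [mul_assoc]
      _ = b⁻¹ * a⁻¹ := by rw [inv_mul_inv, inv_mul_inv]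

theorem natLE_refl (a : S) : NatLE a a := (mul_inv_mul a).symm

theorem mul_idem_natLE {e : S} (he : e * e = e) (b : S) : NatLE (b * e) b := by
  unfold NatLE
  have hc := idem_comm (inv_mul_idem b) he
  rw [inv_mul_rev, inv_of_idem he]
  calc b * e = b * b⁻¹ * b * e * e := by rw [mul_inv_mul, mul_assoc, he]
    _ = b * ((b⁻¹ * b) * e) * e := by simp only [mul_assoc]
    _ = b * (e * b⁻¹) * (b * e) := by rw [hc]; simp only [mul_assoc]

theorem idem_mul_natLE {e : S} (he : e * e = e) (b : S) : NatLE (e * b) b := by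
  have hc := idem_comm (mul_inv_idem b) he
  have h1 : e * b = b * (b⁻¹ * e * b) := by
    calc e * b = e * (b * b⁻¹) * b := by rw [mul_assoc, mul_inv_mul]
      _ = b * (b⁻¹ * e * b) := by rw [← hc]; simp only [mul_assoc]
  have h2 : b⁻¹ * e * b * (b⁻¹ * e * b) = b⁻¹ * e * b := by
    calc b⁻¹ * e * b * (b⁻¹ * e * b) = b⁻¹ * (e * (b * b⁻¹)) * e * b := by
          simp only [mul_assoc]
      _ = (b⁻¹ * b * b⁻¹) * (e * e) * b := by rw [← hc]; simp only [mul_assoc]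
      _ = b⁻¹ * e * b := by rw [he, inv_mul_inv]
  rw [h1]
  exact mul_idem_natLE h2 b

theorem NatLE.eq_mul {a b : S} (h : NatLE a b) : a = b * (a⁻¹ * a) := by
  rw [← mul_assoc]; exact h

theorem NatLE.inv {a b : S} (h : NatLE a b) : NatLE a⁻¹ b⁻¹ := by
  have h1 : a⁻¹ = a⁻¹ * a * b⁻¹ := by
    conv_lhs => rw [h.eq_mul, inv_mul_rev, inv_of_idem (inv_mul_idem a)]
  rw [h1]
  exact idem_mul_natLE (inv_mul_idem a) _

theorem NatLE.eq_mul' {a b : S} (h : NatLE a b) : a = a * a⁻¹ * b := by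
  have h1 := h.inv.eq_mul
  rw [inv_inv_eq] at h1
  have h2 := congrArg (fun t : S => t⁻¹) h1
  simpa only [inv_mul_rev, inv_inv_eq] using h2

theorem NatLE.trans {a b c : S} (h : NatLE a b) (h' : NatLE b c) : NatLE a c := by
  have : a = c * (b⁻¹ * b * (a⁻¹ * a)) := by
    rw [← mul_assoc, ← h'.eq_mul]; exact h.eq_mul
  rw [this]
  exact mul_idem_natLE (idem_mul_idem (inv_mul_idem b) (inv_mul_idem a)) c

theorem NatLE.mul_left {a b : S} (h : NatLE a b) (c : S) : NatLE (c * a) (c * b) := by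
  rw [h.eq_mul, ← mul_assoc]
  exact mul_idem_natLE (inv_mul_idem a) _

theorem NatLE.mul_right {a b : S} (h : NatLE a b) (c : S) : NatLE (a * c) (b * c) := by
  rw [h.eq_mul', mul_assoc]
  exact idem_mul_natLE (mul_inv_idem a) _

theorem NatLE.mul {a b c d : S} (h : NatLE a b) (h' : NatLE c d) : NatLE (a * c) (b * d) :=
  (h.mul_right c).trans (h'.mul_left b)

theorem NatLE.eq_zero {a : S} (h : NatLE a 0) : a = 0 := by
  have := h.eq_mul
  rwa [zero_mul] at this

theorem inv_zero_eq : (0 : S)⁻¹ = 0 := inv_of_idem (zero_mul 0)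

theorem eq_zero_of_inv {a : S} (h : a⁻¹ = 0) : a = 0 := by
  rw [← inv_inv_eq a, h, inv_zero_eq]

theorem eq_zero_of_inv_mul {a : S} (h : a⁻¹ * a = 0) : a = 0 := by
  rw [← mul_inv_mul a, mul_assoc, h, mul_zero]

/-! ### The Lenz congruence -/

/-- `s` and `t` are related if for every `0 < x ≤ s` there is a nonzero element below both `x`
and `t`, and for every `0 < y ≤ t` there is a nonzero element below both `y` and `s`. -/
def LenzRel (s t : S) : Prop :=
  (∀ x : S, x ≠ 0 → NatLE x s → ∃ z : S, z ≠ 0 ∧ NatLE z x ∧ NatLE z t) ∧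
  (∀ y : S, y ≠ 0 → NatLE y t → ∃ z : S, z ≠ 0 ∧ NatLE z y ∧ NatLE z s)

theorem LenzRel.refl (s : S) : LenzRel s s :=
  ⟨fun x hx h => ⟨x, hx, natLE_refl x, h⟩, fun x hx h => ⟨x, hx, natLE_refl x, h⟩⟩

theorem LenzRel.symm {s t : S} (h : LenzRel s t) : LenzRel t s := ⟨h.2, h.1⟩

theorem LenzRel.trans {s t u : S} (h : LenzRel s t) (h' : LenzRel t u) : LenzRel s u := by
  constructor
  · intro x hx hxs
    obtain ⟨z, hz, hzx, hzt⟩ := h.1 x hx hxs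
    obtain ⟨w, hw, hwz, hwu⟩ := h'.1 z hz hzt
    exact ⟨w, hw, hwz.trans hzx, hwu⟩
  · intro x hx hxs
    obtain ⟨z, hz, hzx, hzt⟩ := h'.2 x hx hxs
    obtain ⟨w, hw, hwz, hwu⟩ := h.2 z hz hzt
    exact ⟨w, hw, hwz.trans hzx, hwu⟩

theorem lenz_half_mul_right {s t : S}
    (h : ∀ x : S, x ≠ 0 → NatLE x s → ∃ z : S, z ≠ 0 ∧ NatLE z x ∧ NatLE z t) (u x : S)
    (hx : x ≠ 0) (hxs : NatLE x (s * u)) : ∃ z : S, z ≠ 0 ∧ NatLE z x ∧ NatLE z (t * u) := by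
  have hxu : x * u⁻¹ * u = x := by
    calc x * u⁻¹ * u = x * x⁻¹ * s * (u * u⁻¹ * u) := by
          conv_lhs => rw [hxs.eq_mul']
          simp only [mul_assoc]
      _ = x := by rw [mul_inv_mul, mul_assoc]; exact hxs.eq_mul'.symm
  have hx0 : x * u⁻¹ ≠ 0 := fun h0 => hx (by rw [← hxu, h0, zero_mul])
  have hle : NatLE (x * u⁻¹) s := by
    refine (hxs.mul_right u⁻¹).trans ?_
    rw [mul_assoc]
    exact mul_idem_natLE (mul_inv_idem u) s
  obtain ⟨z, hz, hzx, hzt⟩ := h _ hx0 hle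
  refine ⟨z * u, fun h0 => hz ?_, ?_, hzt.mul_right u⟩
  · have : z = z * u * u⁻¹ := by
      calc z = z * z⁻¹ * (x * u⁻¹) := hzx.eq_mul'
        _ = z * z⁻¹ * (x * (u⁻¹ * u * u⁻¹)) := by rw [inv_mul_inv]
        _ = z * z⁻¹ * (x * u⁻¹) * u * u⁻¹ := by simp only [mul_assoc]
        _ = z * u * u⁻¹ := by rw [← hzx.eq_mul']
    rw [this, h0, zero_mul]
  · have := hzx.mul_right u
    rwa [hxu] at this

theorem LenzRel.mul_right {s t : S} (h : LenzRel s t) (u : S) : LenzRel (s * u) (t * u) :=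
  ⟨lenz_half_mul_right h.1 u, lenz_half_mul_right h.2 u⟩

theorem lenz_half_inv {s t : S}
    (h : ∀ x : S, x ≠ 0 → NatLE x s → ∃ z : S, z ≠ 0 ∧ NatLE z x ∧ NatLE z t) (x : S)
    (hx : x ≠ 0) (hxs : NatLE x s⁻¹) : ∃ z : S, z ≠ 0 ∧ NatLE z x ∧ NatLE z t⁻¹ := by
  have h1 := hxs.inv
  rw [inv_inv_eq] at h1
  obtain ⟨z, hz, hzx, hzt⟩ := h x⁻¹ (fun h0 => hx (eq_zero_of_inv h0)) h1
  have h2 := hzx.inv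
  rw [inv_inv_eq] at h2
  exact ⟨z⁻¹, fun h0 => hz (eq_zero_of_inv h0), h2, hzt.inv⟩

theorem LenzRel.inv {s t : S} (h : LenzRel s t) : LenzRel s⁻¹ t⁻¹ :=
  ⟨lenz_half_inv h.1, lenz_half_inv h.2⟩

theorem LenzRel.mul_left {s t : S} (h : LenzRel s t) (u : S) : LenzRel (u * s) (u * t) := by
  have := (h.inv.mul_right u⁻¹).inv
  simpa only [inv_mul_rev, inv_inv_eq] using this

variable (S) in
/-- The Lenz congruence on an inverse monoid with zero. -/
def lenzCon : Con S where
  r := LenzRel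
  iseqv := ⟨LenzRel.refl, LenzRel.symm, LenzRel.trans⟩
  mul' := fun h h' => (h.mul_right _).trans (h'.mul_left _)

variable (S) in
/-- The quotient of an inverse monoid with zero by its Lenz congruence. -/
def LenzQuotient : Type _ := (lenzCon S).Quotient

/-- The class `[a]` of `a` under the Lenz congruence. -/
def LenzQuotient.mk (a : S) : LenzQuotient S := Con.toQuotient (c := lenzCon S) a

theorem LenzQuotient.ind {p : LenzQuotient S → Prop} (h : ∀ a, p (LenzQuotient.mk a)) (x) : p x :=
  Con.induction_on (c := lenzCon S) x h

/-- The operations of the quotient are induced by those of `S`. -/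
instance : InverseMonoidWithZero (LenzQuotient S) :=
  letI M : Monoid (LenzQuotient S) := inferInstanceAs (Monoid (lenzCon S).Quotient)
  letI I : Inv (LenzQuotient S) :=
    ⟨Quotient.map' (s₁ := (lenzCon S).toSetoid) (s₂ := (lenzCon S).toSetoid)
      (fun a : S => a⁻¹) (fun _ _ h => LenzRel.inv h)⟩
  have hmul : ∀ a b : S, LenzQuotient.mk a * LenzQuotient.mk b = LenzQuotient.mk (a * b) :=
    fun _ _ => rfl
  have hinv : ∀ a : S, (LenzQuotient.mk a)⁻¹ = LenzQuotient.mk a⁻¹ := fun _ => rfl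
  have h1 : ∀ x : LenzQuotient S, x * x⁻¹ * x = x := by
    refine LenzQuotient.ind fun a => ?_
    rw [hinv, hmul, hmul, mul_inv_mul]
  have h2 : ∀ x : LenzQuotient S, x⁻¹⁻¹ = x := by
    refine LenzQuotient.ind fun a => ?_
    rw [hinv, hinv, inv_inv_eq]
  have h3 : ∀ x y : LenzQuotient S, (x * y)⁻¹ = y⁻¹ * x⁻¹ := by
    refine LenzQuotient.ind fun a => LenzQuotient.ind fun b => ?_
    rw [hinv, hinv, hmul, hmul, hinv, inv_mul_rev]
  have h4 : ∀ x y : LenzQuotient S, x * x⁻¹ * (y * y⁻¹) = y * y⁻¹ * (x * x⁻¹) := by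
    refine LenzQuotient.ind fun a => LenzQuotient.ind fun b => ?_
    rw [hinv, hinv, hmul, hmul, hmul, hmul, idem_comm (mul_inv_idem a) (mul_inv_idem b)]
  { M, I with
    zero := LenzQuotient.mk 0
    zero_mul := LenzQuotient.ind fun a => congrArg LenzQuotient.mk (zero_mul a)
    mul_zero := LenzQuotient.ind fun a => congrArg LenzQuotient.mk (mul_zero a)
    mul_inv_mul := h1
    inv_mul_inv := fun x => by simpa only [h2] using h1 x⁻¹
    inv_unique := inv_unique_of_identities h1 h2 h3 h4 }

/-! ### Filters and ultrafilters -/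

/-- A filter: a nonempty, upward closed and downward directed subset. -/
structure IsFilter (A : Set S) : Prop where
  nonempty : A.Nonempty
  up : ∀ a b : S, a ∈ A → NatLE a b → b ∈ A
  dir : ∀ a b : S, a ∈ A → b ∈ A → ∃ c ∈ A, NatLE c a ∧ NatLE c b

/-- A proper filter does not contain `0`. -/
def IsProperFilter (A : Set S) : Prop := IsFilter A ∧ (0 : S) ∉ A

/-- An ultrafilter is a maximal proper filter. -/
def IsUltrafilter (A : Set S) : Prop :=
  IsProperFilter A ∧ ∀ B : Set S, IsProperFilter B → A ⊆ B → A = B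

/-- `(A B)^↑`: the elements above some product `a b` with `a ∈ A`, `b ∈ B`. -/
def upMul (A B : Set S) : Set S := {x | ∃ a ∈ A, ∃ b ∈ B, NatLE (a * b) x}

/-- `A⁻¹`, the set of inverses of the elements of `A`. -/
def invSet (A : Set S) : Set S := {x | ∃ a ∈ A, a⁻¹ = x}

/-- `d(A) = (A⁻¹ A)^↑`. -/
def dSet (A : Set S) : Set S := upMul (invSet A) A

/-- `r(A) = (A A⁻¹)^↑`. -/
def rSet (A : Set S) : Set S := upMul A (invSet A)

theorem mem_invSet {A : Set S} {x : S} : x ∈ invSet A ↔ x⁻¹ ∈ A :=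
  ⟨fun ⟨a, ha, h⟩ => by rwa [← h, inv_inv_eq], fun h => ⟨x⁻¹, h, inv_inv_eq x⟩⟩

theorem invSet_invSet (A : Set S) : invSet (invSet A) = A := by
  ext x; rw [mem_invSet, mem_invSet, inv_inv_eq]

theorem invSet_upMul (A B : Set S) : invSet (upMul A B) = upMul (invSet B) (invSet A) := by
  ext x
  rw [mem_invSet]
  constructor
  · rintro ⟨a, ha, b, hb, h⟩
    have h' := h.inv
    rw [inv_inv_eq, inv_mul_rev] at h'
    exact ⟨b⁻¹, ⟨b, hb, rfl⟩, a⁻¹, ⟨a, ha, rfl⟩, h'⟩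
  · rintro ⟨_, ⟨b, hb, rfl⟩, _, ⟨a, ha, rfl⟩, h⟩
    have h' := h.inv
    rw [inv_mul_rev, inv_inv_eq, inv_inv_eq] at h'
    exact ⟨a, ha, b, hb, h'⟩

theorem dSet_invSet (A : Set S) : dSet (invSet A) = rSet A := by
  unfold dSet rSet; rw [invSet_invSet]

theorem rSet_invSet (A : Set S) : rSet (invSet A) = dSet A := by
  unfold dSet rSet; rw [invSet_invSet]

theorem IsFilter.invSet {A : Set S} (h : IsFilter A) : IsFilter (invSet A) where
  nonempty := h.nonempty.elim fun a ha => ⟨a⁻¹, a, ha, rfl⟩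
  up := fun a b ha hab => mem_invSet.2 (h.up _ _ (mem_invSet.1 ha) hab.inv)
  dir := fun a b ha hb => by
    obtain ⟨c, hc, h1, h2⟩ := h.dir _ _ (mem_invSet.1 ha) (mem_invSet.1 hb)
    have h1' := h1.inv
    have h2' := h2.inv
    rw [inv_inv_eq] at h1' h2'
    exact ⟨c⁻¹, ⟨c, hc, rfl⟩, h1', h2'⟩

theorem IsProperFilter.invSet {A : Set S} (h : IsProperFilter A) : IsProperFilter (invSet A) :=
  ⟨h.1.invSet, fun h0 => h.2 (by have := mem_invSet.1 h0; rwa [inv_zero_eq] at this)⟩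

theorem invSet_mono {A B : Set S} (h : A ⊆ B) : invSet A ⊆ invSet B :=
  fun _ ⟨a, ha, e⟩ => ⟨a, h ha, e⟩

theorem upMul_mono {A B A' B' : Set S} (h : A ⊆ A') (h' : B ⊆ B') : upMul A B ⊆ upMul A' B' :=
  fun _ ⟨a, ha, b, hb, hx⟩ => ⟨a, h ha, b, h' hb, hx⟩

theorem dSet_mono {A B : Set S} (h : A ⊆ B) : dSet A ⊆ dSet B := upMul_mono (invSet_mono h) h

theorem IsUltrafilter.invSet {A : Set S} (h : IsUltrafilter A) : IsUltrafilter (invSet A) := by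
  refine ⟨h.1.invSet, fun B hB hAB => ?_⟩
  have h1 := invSet_mono hAB
  rw [invSet_invSet] at h1
  rw [h.2 _ hB.invSet h1, invSet_invSet]

theorem mem_dSet {A : Set S} (hA : IsFilter A) {x : S} :
    x ∈ dSet A ↔ ∃ a ∈ A, NatLE (a⁻¹ * a) x := by
  constructor
  · rintro ⟨_, ⟨a, ha, rfl⟩, b, hb, h⟩
    obtain ⟨c, hc, h1, h2⟩ := hA.dir a b ha hb
    exact ⟨c, hc, (h1.inv.mul h2).trans h⟩
  · rintro ⟨a, ha, h⟩
    exact ⟨a⁻¹, ⟨a, ha, rfl⟩, a, ha, h⟩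

theorem isFilter_upMul {A B : Set S} (hA : IsFilter A) (hB : IsFilter B) :
    IsFilter (upMul A B) where
  nonempty := by
    obtain ⟨a, ha⟩ := hA.nonempty
    obtain ⟨b, hb⟩ := hB.nonempty
    exact ⟨a * b, a, ha, b, hb, natLE_refl _⟩
  up := fun x y ⟨a, ha, b, hb, h⟩ hxy => ⟨a, ha, b, hb, h.trans hxy⟩
  dir := by
    rintro x y ⟨a, ha, b, hb, h⟩ ⟨a', ha', b', hb', h'⟩
    obtain ⟨c, hc, h1, h2⟩ := hA.dir a a' ha ha'
    obtain ⟨d, hd, h3, h4⟩ := hB.dir b b' hb hb'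
    exact ⟨c * d, ⟨c, hc, d, hd, natLE_refl _⟩, (h1.mul h3).trans h, (h2.mul h4).trans h'⟩

theorem IsProperFilter.dSet {A : Set S} (h : IsProperFilter A) : IsProperFilter (dSet A) := by
  refine ⟨isFilter_upMul h.1.invSet h.1, fun h0 => ?_⟩
  obtain ⟨a, ha, h1⟩ := (mem_dSet h.1).1 h0
  rw [eq_zero_of_inv_mul h1.eq_zero] at ha
  exact h.2 ha

theorem mul_mem_of_mem_dSet {A : Set S} (hA : IsFilter A) {a x : S} (ha : a ∈ A)
    (hx : x ∈ dSet A) : a * x ∈ A := by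
  obtain ⟨b, hb, h⟩ := (mem_dSet hA).1 hx
  obtain ⟨c, hc, h1, h2⟩ := hA.dir a b ha hb
  refine hA.up c _ hc ?_
  have h3 := h1.mul ((h2.inv.mul h2).trans h)
  rwa [← mul_assoc, mul_inv_mul] at h3

theorem eq_of_subset_of_dSet_eq {A B : Set S} (hA : IsFilter A) (hB : IsFilter B) (hAB : A ⊆ B)
    (hd : dSet B ⊆ dSet A) : A = B := by
  refine hAB.antisymm fun b hb => ?_
  obtain ⟨a, ha⟩ := hA.nonempty
  obtain ⟨c, hc, h1, h2⟩ := hB.dir a b (hAB ha) hb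
  have h3 : c⁻¹ * c ∈ dSet A := hd ((mem_dSet hB).2 ⟨c, hc, natLE_refl _⟩)
  have h4 := mul_mem_of_mem_dSet hA ha h3
  rw [← h1.eq_mul] at h4
  exact hA.up c b h4 h2

theorem IsUltrafilter.dSet {A : Set S} (h : IsUltrafilter A) : IsUltrafilter (dSet A) := by
  refine ⟨h.1.dSet, fun B hB hAB => hAB.antisymm fun b hb => ?_⟩
  obtain ⟨a, ha⟩ := h.1.1.nonempty
  have hdB : a⁻¹ * a ∈ B := hAB ((mem_dSet h.1.1).2 ⟨a, ha, natLE_refl _⟩)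
  set C : Set S := {x | ∃ b ∈ B, NatLE (a * b) x} with hC
  have hCf : IsProperFilter C := by
    refine ⟨⟨⟨a * b, b, hb, natLE_refl _⟩, fun x y ⟨b, hb, h⟩ hxy => ⟨b, hb, h.trans hxy⟩, ?_⟩, ?_⟩
    · rintro x y ⟨b, hb, h⟩ ⟨b', hb', h'⟩
      obtain ⟨c, hc, h1, h2⟩ := hB.1.dir b b' hb hb'
      exact ⟨a * c, ⟨c, hc, natLE_refl _⟩, (h1.mul_left a).trans h, (h2.mul_left a).trans h'⟩
    · rintro ⟨b, hb, h⟩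
      obtain ⟨c, hc, h1, h2⟩ := hB.1.dir b _ hb hdB
      have h3 : a * c = 0 := ((h1.mul_left a).trans h).eq_zero
      have h4 : c = a⁻¹ * (a * c) := by
        calc c = a⁻¹ * a * (c⁻¹ * c) := h2.eq_mul
          _ = a⁻¹ * a * (a⁻¹ * a) * (c⁻¹ * c) := by rw [inv_mul_idem]
          _ = a⁻¹ * a * c := by rw [mul_assoc, ← h2.eq_mul]
          _ = a⁻¹ * (a * c) := mul_assoc _ _ _
      rw [h3, mul_zero] at h4
      rw [h4] at hc
      exact hB.2 hc
  have hAC : A ⊆ C := by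
    intro x hx
    obtain ⟨c, hc, h1, h2⟩ := h.1.1.dir a x ha hx
    refine ⟨c⁻¹ * c, hAB ((mem_dSet h.1.1).2 ⟨c, hc, natLE_refl _⟩), ?_⟩
    rwa [← h1.eq_mul]
  have hEq := h.2 C hCf hAC
  have hab : a * b ∈ A := by rw [hEq]; exact ⟨b, hb, natLE_refl _⟩
  refine ⟨a⁻¹, ⟨a, ha, rfl⟩, a * b, hab, ?_⟩
  rw [← mul_assoc]
  exact idem_mul_natLE (inv_mul_idem a) b

theorem IsUltrafilter.rSet {A : Set S} (h : IsUltrafilter A) : IsUltrafilter (rSet A) := by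
  rw [← dSet_invSet]; exact h.invSet.dSet

theorem dSet_subset_dSet_upMul {A B : Set S} (hA : IsFilter A) (hB : IsFilter B) :
    dSet B ⊆ dSet (upMul A B) := by
  intro x hx
  obtain ⟨b, hb, h⟩ := (mem_dSet hB).1 hx
  obtain ⟨a, ha⟩ := hA.nonempty
  refine (mem_dSet (isFilter_upMul hA hB)).2 ⟨a * b, ⟨a, ha, b, hb, natLE_refl _⟩, ?_⟩
  refine NatLE.trans ?_ h
  have := ((idem_mul_natLE (inv_mul_idem a) b).mul_left b⁻¹)
  simpa only [inv_mul_rev, mul_assoc] using this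

theorem rSet_subset_rSet_upMul {A B : Set S} (hA : IsFilter A) (hB : IsFilter B) :
    rSet A ⊆ rSet (upMul A B) := by
  have h := dSet_subset_dSet_upMul hB.invSet hA.invSet
  rwa [dSet_invSet, ← invSet_upMul, dSet_invSet] at h

theorem IsUltrafilter.upMul {A B : Set S} (hA : IsUltrafilter A) (hB : IsUltrafilter B)
    (hAB : CuntzGroupoid.dSet A = CuntzGroupoid.rSet B) : IsUltrafilter (upMul A B) := by
  have hP : IsProperFilter (CuntzGroupoid.upMul A B) := by
    refine ⟨isFilter_upMul hA.1.1 hB.1.1, ?_⟩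
    rintro ⟨a, ha, b, hb, h⟩
    have h1 : a⁻¹ * a ∈ CuntzGroupoid.rSet B := by
      rw [← hAB]; exact (mem_dSet hA.1.1).2 ⟨a, ha, natLE_refl _⟩
    have h2 : b * b⁻¹ ∈ CuntzGroupoid.rSet B := ⟨b, hb, b⁻¹, ⟨b, hb, rfl⟩, natLE_refl _⟩
    obtain ⟨c, hc, h3, h4⟩ := hB.rSet.1.1.dir _ _ h1 h2
    have h5 : c = a⁻¹ * a * (b * b⁻¹) * (c⁻¹ * c) := by
      rw [mul_assoc, ← h4.eq_mul]
      calc c = a⁻¹ * a * (c⁻¹ * c) := h3.eq_mul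
        _ = a⁻¹ * a * (a⁻¹ * a) * (c⁻¹ * c) := by rw [inv_mul_idem]
        _ = a⁻¹ * a * c := by rw [mul_assoc, ← h3.eq_mul]
    have h6 : a⁻¹ * a * (b * b⁻¹) = a⁻¹ * (a * b) * b⁻¹ := by simp only [mul_assoc]
    rw [h6, h.eq_zero, mul_zero, zero_mul, zero_mul] at h5
    rw [h5] at hc
    exact hB.rSet.1.2 hc
  refine ⟨hP, fun C hC hsub => eq_of_subset_of_dSet_eq hP.1 hC.1 hsub ?_⟩
  have h1 := dSet_subset_dSet_upMul hA.1.1 hB.1.1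
  have h2 := hB.dSet.2 _ hP.dSet h1
  have h3 := hB.dSet.2 _ hC.dSet (h1.trans (dSet_mono hsub))
  rw [← h2, ← h3]

end InverseMonoid

/-! ### Groupoids as sets of arrows -/

/-- A groupoid presented by its set of arrows: objects are identified with identity arrows, `d` and
`r` give the domain and range identities, and `comp a b` is defined when `d a = r b`. -/
class ArrowGroupoid (G : Type*) where
  d : G → G
  r : G → G
  inv : G → G
  comp : (a b : G) → d a = r b → G
  d_d : ∀ a, d (d a) = d a
  r_d : ∀ a, r (d a) = d a
  d_r : ∀ a, d (r a) = r a
  r_r : ∀ a, r (r a) = r a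
  d_comp : ∀ a b h, d (comp a b h) = d b
  r_comp : ∀ a b h, r (comp a b h) = r a
  comp_assoc : ∀ a b c (hab : d a = r b) (hbc : d b = r c),
    comp (comp a b hab) c ((d_comp a b hab).trans hbc) =
      comp a (comp b c hbc) (hab.trans (r_comp b c hbc).symm)
  comp_d : ∀ a, comp a (d a) (r_d a).symm = a
  r_comp_self : ∀ a, comp (r a) a (d_r a) = a
  d_inv : ∀ a, d (inv a) = r a
  r_inv : ∀ a, r (inv a) = d a
  inv_comp : ∀ a, comp (inv a) a (d_inv a) = d a
  comp_inv : ∀ a, comp a (inv a) (r_inv a).symm = r a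

/-- A groupoid with a topology on its arrows is étale if inversion and composition are continuous
and the domain map onto the space of identities is a local homeomorphism. -/
structure IsEtaleGroupoid (G : Type*) [ArrowGroupoid G] [TopologicalSpace G] : Prop where
  continuous_inv : Continuous (ArrowGroupoid.inv : G → G)
  continuous_comp : Continuous
    (fun p : {p : G × G // ArrowGroupoid.d p.1 = ArrowGroupoid.r p.2} =>
      ArrowGroupoid.comp p.1.1 p.1.2 p.2)
  isLocalHomeomorph_d : IsLocalHomeomorph
    (fun a : G => (⟨ArrowGroupoid.d a, ArrowGroupoid.d_d a⟩ : {e : G // ArrowGroupoid.d e = e}))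

/-- An isomorphism of topological groupoids: a homeomorphism between the sets of arrows that
preserves and reflects composability and preserves composites. -/
structure TopGroupoidIso (G H : Type*) [ArrowGroupoid G] [TopologicalSpace G] [ArrowGroupoid H]
    [TopologicalSpace H] extends G ≃ₜ H where
  composable_iff : ∀ a b : G, ArrowGroupoid.d a = ArrowGroupoid.r b ↔
    ArrowGroupoid.d (toFun a) = ArrowGroupoid.r (toFun b)
  map_comp : ∀ (a b : G) (h : ArrowGroupoid.d a = ArrowGroupoid.r b),
    toFun (ArrowGroupoid.comp a b h) =
      ArrowGroupoid.comp (toFun a) (toFun b) ((composable_iff a b).1 h)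

/-! ### The groupoid of ultrafilters -/

section UltrafilterGroupoid

variable (S : Type*) [InverseMonoidWithZero S]

/-- `G(S)`, the set of all ultrafilters of `S`. -/
def UltrafilterGroupoid : Type _ := {A : Set S // IsUltrafilter A}

variable {S}

theorem ultrafilter_eq_of_subset {A B : UltrafilterGroupoid S} (h : A.1 ⊆ B.1) : A = B :=
  Subtype.ext (A.2.2 B.1 B.2.1 h)

/-- The basic open set `V_s` of all ultrafilters that contain `s`. -/
def ultrafiltersContaining (s : S) : Set (UltrafilterGroupoid S) := {A | s ∈ A.1}

/-- The topology generated by the sets `V_s`. -/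
instance : TopologicalSpace (UltrafilterGroupoid S) :=
  TopologicalSpace.generateFrom {U | ∃ s : S, U = ultrafiltersContaining s}

theorem dSet_ultrafilter_subset {A : Set S} (hA : IsUltrafilter A) : dSet (dSet A) ⊆ dSet A := by
  intro x hx
  obtain ⟨y, hy, h⟩ := (mem_dSet hA.dSet.1.1).1 hx
  obtain ⟨a, ha, h'⟩ := (mem_dSet hA.1.1).1 hy
  refine (mem_dSet hA.1.1).2 ⟨a, ha, NatLE.trans ?_ h⟩
  have h1 := h'.inv.mul h'
  rwa [inv_of_idem (inv_mul_idem a), inv_mul_idem] at h1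

theorem invSet_dSet (A : Set S) : invSet (dSet A) = dSet A := by
  unfold dSet; rw [invSet_upMul, invSet_invSet]

theorem dSet_dSet {A : Set S} (hA : IsUltrafilter A) : dSet (dSet A) = dSet A :=
  hA.dSet.dSet.2 _ hA.dSet.1 (dSet_ultrafilter_subset hA)

theorem rSet_dSet {A : Set S} (hA : IsUltrafilter A) : rSet (dSet A) = dSet A := by
  rw [← dSet_invSet, invSet_dSet, dSet_dSet hA]

/-- The groupoid structure on the ultrafilters: `d(A) = (A⁻¹A)^↑`, `r(A) = (AA⁻¹)^↑`, the inverse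
of `A` is `A⁻¹`, and `A · B = (AB)^↑` when `d(A) = r(B)`. -/
instance : ArrowGroupoid (UltrafilterGroupoid S) where
  d A := ⟨dSet A.1, A.2.dSet⟩
  r A := ⟨rSet A.1, A.2.rSet⟩
  inv A := ⟨invSet A.1, A.2.invSet⟩
  comp A B h := ⟨upMul A.1 B.1, A.2.upMul B.2 (congrArg Subtype.val h)⟩
  d_d A := Subtype.ext (dSet_dSet A.2)
  r_d A := Subtype.ext (rSet_dSet A.2)
  d_r A := Subtype.ext (by simpa only [dSet_invSet] using dSet_dSet A.2.invSet)
  r_r A := Subtype.ext (by simpa only [dSet_invSet] using rSet_dSet A.2.invSet)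
  d_comp A B _ := (ultrafilter_eq_of_subset (dSet_subset_dSet_upMul A.2.1.1 B.2.1.1)).symm
  r_comp A B _ := (ultrafilter_eq_of_subset (rSet_subset_rSet_upMul A.2.1.1 B.2.1.1)).symm
  comp_assoc A B C _ _ := by
    apply ultrafilter_eq_of_subset
    rintro x ⟨u, ⟨a, ha, b, hb, h⟩, c, hc, h'⟩
    refine ⟨a, ha, b * c, ⟨b, hb, c, hc, natLE_refl _⟩, ?_⟩
    rw [← mul_assoc]
    exact (h.mul_right c).trans h'
  comp_d A := by
    symm
    apply ultrafilter_eq_of_subset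
    intro a ha
    refine ⟨a, ha, a⁻¹ * a, ⟨a⁻¹, ⟨a, ha, rfl⟩, a, ha, natLE_refl _⟩, ?_⟩
    rw [← mul_assoc, InverseMonoidWithZero.mul_inv_mul]
    exact natLE_refl a
  r_comp_self A := by
    symm
    apply ultrafilter_eq_of_subset
    intro a ha
    refine ⟨a * a⁻¹, ⟨a, ha, a⁻¹, ⟨a, ha, rfl⟩, natLE_refl _⟩, a, ha, ?_⟩
    rw [InverseMonoidWithZero.mul_inv_mul]
    exact natLE_refl a
  d_inv A := Subtype.ext (dSet_invSet A.1)
  r_inv A := Subtype.ext (rSet_invSet A.1)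
  inv_comp _ := rfl
  comp_inv _ := rfl

end UltrafilterGroupoid

/-! ### The monoid of bijective morphisms between finitely generated right ideals -/

/-- The free monoid `A_n^*` on the alphabet `A_n = Fin n`. -/
abbrev Words (n : ℕ) : Type := FreeMonoid (Fin n)

/-- `R = X A_n^*` for some finite set `X` of words. -/
def IsFGRightIdeal {n : ℕ} (R : Set (Words n)) : Prop :=
  ∃ X : Set (Words n), X.Finite ∧ R = {r | ∃ x ∈ X, ∃ s : Words n, r = x * s}

theorem isFGRightIdeal_inter {n : ℕ} {R T : Set (Words n)} (hR : IsFGRightIdeal R)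
    (hT : IsFGRightIdeal T) : IsFGRightIdeal (R ∩ T) := by
  obtain ⟨X, hX, rfl⟩ := hR
  obtain ⟨Y, hY, rfl⟩ := hT
  refine ⟨{x ∈ X | ∃ y ∈ Y, ∃ s, x = y * s} ∪ {y ∈ Y | ∃ x ∈ X, ∃ s, y = x * s},
    (hX.sep _).union (hY.sep _), ?_⟩
  ext w
  constructor
  · rintro ⟨⟨x, hx, s, rfl⟩, ⟨y, hy, t, h⟩⟩
    have h' : x.toList ++ s.toList = y.toList ++ t.toList := congrArg FreeMonoid.toList h
    rcases List.append_eq_append_iff.1 h' with ⟨u, h1, _⟩ | ⟨u, h1, _⟩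
    · have h3 : y = x * FreeMonoid.ofList u := h1
      exact ⟨y, Or.inr ⟨hy, x, hx, _, h3⟩, t, h⟩
    · have h3 : x = y * FreeMonoid.ofList u := h1
      exact ⟨x, Or.inl ⟨hx, y, hy, _, h3⟩, s, rfl⟩
  · rintro ⟨z, ⟨hx, y, hy, s, rfl⟩ | ⟨hy, x, hx, s, rfl⟩, t, rfl⟩
    · exact ⟨⟨_, hx, t, rfl⟩, ⟨y, hy, s * t, mul_assoc _ _ _⟩⟩
    · exact ⟨⟨x, hx, s * t, mul_assoc _ _ _⟩, ⟨_, hy, t, rfl⟩⟩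

/-- `D_n`: the bijective morphisms `θ : R₁ → R₂` between finitely generated right ideals of `A_n^*`,
that is, the partial bijections `θ` with domain `R₁` and range `R₂` such that
`θ(r s) = θ(r) s` for all `r ∈ R₁` and all words `s`. -/
@[ext]
structure DistMonoid (n : ℕ) where
  toPEquiv : Words n ≃. Words n
  fg_dom : IsFGRightIdeal {w | (toPEquiv w).isSome}
  fg_ran : IsFGRightIdeal {w | (toPEquiv.symm w).isSome}
  map_mul : ∀ w v s : Words n, toPEquiv w = some v → toPEquiv (w * s) = some (v * s)

namespace DistMonoid

variable {n : ℕ}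

theorem symm_map_mul (f : DistMonoid n) (w v s : Words n) (h : f.toPEquiv.symm w = some v) :
    f.toPEquiv.symm (w * s) = some (v * s) := by
  rw [PEquiv.eq_some_iff] at h ⊢
  exact f.map_mul _ _ _ h

/-- The preimage of a finitely generated right ideal under an element of `D_n`. -/
theorem isFGRightIdeal_preimage (p : Words n ≃. Words n)
    (hs : ∀ w v s : Words n, p w = some v → p (w * s) = some (v * s))
    (hr : IsFGRightIdeal {w | (p.symm w).isSome}) {T : Set (Words n)} (hT : IsFGRightIdeal T) :
    IsFGRightIdeal {w | ∃ v ∈ T, p w = some v} := by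
  obtain ⟨Z, hZ, hZe⟩ := isFGRightIdeal_inter hr hT
  have hmem : ∀ z ∈ Z, (p.symm z).isSome ∧ z ∈ T := by
    intro z hz
    have : z ∈ {w | (p.symm w).isSome} ∩ T := by
      rw [hZe]; exact ⟨z, hz, 1, (mul_one z).symm⟩
    exact this
  refine ⟨{w | ∃ z ∈ Z, p w = some z}, ?_, ?_⟩
  · have : {w | ∃ z ∈ Z, p w = some z} ⊆ (fun z => (p.symm z).getD 1) '' Z := by
      rintro w ⟨z, hz, h⟩
      refine ⟨z, hz, ?_⟩
      have h' : p.symm z = some w := (PEquiv.eq_some_iff p).2 h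
      simp [h']
    exact (hZ.image _).subset this
  · ext w
    constructor
    · rintro ⟨v, hv, h⟩
      have h' : p.symm v = some w := (PEquiv.eq_some_iff p).2 h
      have hv' : v ∈ {w | (p.symm w).isSome} ∩ T := ⟨by simp [h'], hv⟩
      rw [hZe] at hv'
      obtain ⟨z, hz, s, rfl⟩ := hv'
      obtain ⟨u, hu⟩ := Option.isSome_iff_exists.1 (hmem z hz).1
      have hu' : p u = some z := (PEquiv.eq_some_iff p).1 hu
      exact ⟨u, ⟨z, hz, hu'⟩, s, p.inj h (hs _ _ s hu')⟩
    · rintro ⟨u, ⟨z, hz, hu⟩, s, rfl⟩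
      have hv' : z * s ∈ {w | (p.symm w).isSome} ∩ T := by
        rw [hZe]; exact ⟨z, hz, s, rfl⟩
      exact ⟨z * s, hv'.2, hs _ _ s hu⟩

theorem isSome_trans (p q : Words n ≃. Words n) :
    {w | ((p.trans q) w).isSome} = {w | ∃ v ∈ {v | (q v).isSome}, p w = some v} := by
  ext w
  simp only [Set.mem_ofPred_eq, Option.isSome_iff_exists, PEquiv.trans_eq_some]
  constructor
  · rintro ⟨c, b, h1, h2⟩; exact ⟨b, ⟨c, h2⟩, h1⟩
  · rintro ⟨b, ⟨c, h2⟩, h1⟩; exact ⟨c, b, h1, h2⟩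

/-- Composition of partial functions, `(f g)(w) = f(g(w))`. -/
instance : Mul (DistMonoid n) where
  mul f g :=
    { toPEquiv := g.toPEquiv.trans f.toPEquiv
      fg_dom := by
        rw [isSome_trans]
        exact isFGRightIdeal_preimage _ g.map_mul g.fg_ran f.fg_dom
      fg_ran := by
        rw [PEquiv.symm_trans_rev, isSome_trans]
        exact isFGRightIdeal_preimage _ f.symm_map_mul f.fg_dom g.fg_ran
      map_mul := by
        intro w v s h
        rw [PEquiv.trans_eq_some] at h ⊢
        obtain ⟨b, h1, h2⟩ := h
        exact ⟨b * s, g.map_mul _ _ s h1, f.map_mul _ _ s h2⟩ }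

/-- The identity morphism of `A_n^*`. -/
instance : One (DistMonoid n) where
  one :=
    { toPEquiv := PEquiv.refl _
      fg_dom := ⟨{1}, Set.finite_singleton _, by ext w; simp⟩
      fg_ran := ⟨{1}, Set.finite_singleton _, by ext w; simp⟩
      map_mul := by intro w v s h; simp_all }

/-- The empty partial function. -/
instance : Zero (DistMonoid n) where
  zero :=
    { toPEquiv := ⊥
      fg_dom := ⟨∅, Set.finite_empty, by ext w; simp⟩
      fg_ran := ⟨∅, Set.finite_empty, by ext w; simp⟩
      map_mul := by intro w v s h; simp at h }

/-- The inverse partial bijection. -/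
instance : Inv (DistMonoid n) where
  inv f :=
    { toPEquiv := f.toPEquiv.symm
      fg_dom := f.fg_ran
      fg_ran := f.fg_dom
      map_mul := f.symm_map_mul }

theorem toPEquiv_mul (f g : DistMonoid n) :
    (f * g).toPEquiv = g.toPEquiv.trans f.toPEquiv := rfl

theorem toPEquiv_inv (f : DistMonoid n) : (f⁻¹).toPEquiv = f.toPEquiv.symm := rfl

instance : MonoidWithZero (DistMonoid n) where
  mul_assoc f g h := DistMonoid.ext (PEquiv.trans_assoc _ _ _).symm
  one_mul f := DistMonoid.ext (PEquiv.trans_refl _)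
  mul_one f := DistMonoid.ext (PEquiv.refl_trans _)
  zero_mul f := DistMonoid.ext (PEquiv.trans_bot _)
  mul_zero f := DistMonoid.ext (PEquiv.bot_trans _)

theorem mul_inv_mul_self (f : DistMonoid n) : f * f⁻¹ * f = f := by
  apply DistMonoid.ext
  apply PEquiv.ext
  intro w
  apply Option.ext
  intro v
  simp only [toPEquiv_mul, toPEquiv_inv]
  simp only [PEquiv.trans_eq_some, PEquiv.eq_some_iff]
  constructor
  · rintro ⟨b, hb, c, hc, hv⟩
    rw [f.toPEquiv.inj hb hc]
    exact hv
  · intro h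
    exact ⟨v, h, w, h, h⟩

theorem inv_inv_self (f : DistMonoid n) : (f⁻¹)⁻¹ = f := rfl

theorem inv_mul_rev (f g : DistMonoid n) : (f * g)⁻¹ = g⁻¹ * f⁻¹ := rfl

theorem mul_inv_eq_some (f : DistMonoid n) (w v : Words n) :
    (f * f⁻¹).toPEquiv w = some v ↔ w = v ∧ ∃ u, f.toPEquiv u = some v := by
  simp only [toPEquiv_mul, toPEquiv_inv, PEquiv.trans_eq_some, PEquiv.eq_some_iff]
  constructor
  · rintro ⟨b, h1, h2⟩
    exact ⟨by rw [h1] at h2; exact Option.some.inj h2, b, h2⟩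
  · rintro ⟨rfl, u, h⟩
    exact ⟨u, h, h⟩

theorem mul_inv_comm (f g : DistMonoid n) :
    f * f⁻¹ * (g * g⁻¹) = g * g⁻¹ * (f * f⁻¹) := by
  apply DistMonoid.ext
  apply PEquiv.ext
  intro w
  apply Option.ext
  intro v
  rw [toPEquiv_mul, toPEquiv_mul (g * g⁻¹)]
  simp only [PEquiv.trans_eq_some, mul_inv_eq_some]
  constructor
  · rintro ⟨b, ⟨rfl, h1⟩, rfl, h2⟩; exact ⟨w, ⟨rfl, h2⟩, rfl, h1⟩
  · rintro ⟨b, ⟨rfl, h1⟩, rfl, h2⟩; exact ⟨w, ⟨rfl, h2⟩, rfl, h1⟩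

instance : InverseMonoidWithZero (DistMonoid n) where
  mul_inv_mul := mul_inv_mul_self
  inv_mul_inv f := mul_inv_mul_self f⁻¹
  inv_unique :=
    inv_unique_of_identities mul_inv_mul_self inv_inv_self inv_mul_rev mul_inv_comm

end DistMonoid

/-- The Cuntz inverse monoid `C_n`, the quotient of `D_n` by the Lenz congruence. -/
abbrev CuntzInverseMonoid (n : ℕ) : Type := LenzQuotient (DistMonoid n)

/-! ### The groupoid of the Cuntz algebra -/

/-- `A_n^ω`, the right-infinite strings over `A_n = Fin n`, with the product topology of the
discrete topologies; its open sets are the sets `X A_n^ω` with `X` a set of finite strings. -/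
abbrev InfWords (n : ℕ) : Type := ℕ → Fin n

/-- The right-infinite string `x w`: the finite string `x` followed by `w`. -/
def prepend {n : ℕ} (x : Words n) (w : InfWords n) : InfWords n :=
  fun k => if h : k < x.toList.length then x.toList[k] else w (k - x.toList.length)

/-- The set of arrows of the Cuntz groupoid: the triples `(x w, |x| - |y|, y w)`. -/
def CuntzGpd (n : ℕ) : Type :=
  {t : InfWords n × ℤ × InfWords n // ∃ (x y : Words n) (w : InfWords n),
    t = (prepend x w, (x.length : ℤ) - (y.length : ℤ), prepend y w)}

namespace CuntzGpd

variable {n : ℕ}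

/-- The arrow `(x w, |x| - |y|, y w)`. -/
def mk (x y : Words n) (w : InfWords n) : CuntzGpd n :=
  ⟨(prepend x w, (x.length : ℤ) - (y.length : ℤ), prepend y w), x, y, w, rfl⟩

/-- The basic open set `U_{x,y,V} = {(x w, |x| - |y|, y w) : w ∈ V}`. -/
def basicOpen (x y : Words n) (V : Set (InfWords n)) : Set (CuntzGpd n) :=
  {g | ∃ w ∈ V, g = mk x y w}

/-- The topology generated by the sets `U_{x,y,V}` with `V` open. -/
instance : TopologicalSpace (CuntzGpd n) :=
  TopologicalSpace.generateFrom
    {U | ∃ (x y : Words n) (V : Set (InfWords n)), IsOpen V ∧ U = basicOpen x y V}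

theorem prepend_add (x : Words n) (w : InfWords n) (m : ℕ) : prepend x w (x.length + m) = w m := by
  have : ¬ x.toList.length + m < x.toList.length := by omega
  simp [prepend, FreeMonoid.length]

theorem eq_prepend (z w : InfWords n) (i : ℕ) (h : ∀ m, z (i + m) = w m) :
    ∃ x : Words n, x.length = i ∧ z = prepend x w := by
  refine ⟨FreeMonoid.ofList (List.ofFn fun k : Fin i => z k), by simp [FreeMonoid.length], ?_⟩
  funext k
  simp only [prepend, FreeMonoid.toList_ofList, List.length_ofFn, List.getElem_ofFn]
  split_ifs with hk
  · rfl
  · rw [← h]; congr 1; omega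

/-- A triple is an arrow if and only if its outer entries agree after deleting initial segments
whose lengths differ by the middle entry. -/
theorem exists_iff (z z' : InfWords n) (k : ℤ) :
    (∃ (x y : Words n) (w : InfWords n),
      (z, k, z') = (prepend x w, (x.length : ℤ) - (y.length : ℤ), prepend y w)) ↔
    ∃ i j : ℕ, (i : ℤ) - j = k ∧ ∀ m, z (i + m) = z' (j + m) := by
  constructor
  · rintro ⟨x, y, w, h⟩
    simp only [Prod.mk.injEq] at h
    obtain ⟨rfl, rfl, rfl⟩ := h
    exact ⟨x.length, y.length, rfl, fun m => by rw [prepend_add, prepend_add]⟩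
  · rintro ⟨i, j, rfl, h⟩
    obtain ⟨x, hx, hz⟩ := eq_prepend z (fun m => z' (j + m)) i h
    obtain ⟨y, hy, hz'⟩ := eq_prepend z' (fun m => z' (j + m)) j fun _ => rfl
    exact ⟨x, y, _, by rw [hx, hy, ← hz, ← hz']⟩

theorem exists_unit (z : InfWords n) : ∃ (x y : Words n) (w : InfWords n),
    (z, (0 : ℤ), z) = (prepend x w, (x.length : ℤ) - (y.length : ℤ), prepend y w) :=
  (exists_iff _ _ _).2 ⟨0, 0, by simp, fun _ => rfl⟩

theorem exists_inv {z z' : InfWords n} {k : ℤ} (h : ∃ (x y : Words n) (w : InfWords n),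
    (z, k, z') = (prepend x w, (x.length : ℤ) - (y.length : ℤ), prepend y w)) :
    ∃ (x y : Words n) (w : InfWords n),
      (z', -k, z) = (prepend x w, (x.length : ℤ) - (y.length : ℤ), prepend y w) := by
  rw [exists_iff] at h ⊢
  obtain ⟨i, j, rfl, h⟩ := h
  exact ⟨j, i, by ring, fun m => (h m).symm⟩

theorem exists_comp {z z' z'' : InfWords n} {k l : ℤ} (h : ∃ (x y : Words n) (w : InfWords n),
    (z, k, z') = (prepend x w, (x.length : ℤ) - (y.length : ℤ), prepend y w))
    (h' : ∃ (x y : Words n) (w : InfWords n),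
    (z', l, z'') = (prepend x w, (x.length : ℤ) - (y.length : ℤ), prepend y w)) :
    ∃ (x y : Words n) (w : InfWords n),
      (z, k + l, z'') = (prepend x w, (x.length : ℤ) - (y.length : ℤ), prepend y w) := by
  rw [exists_iff] at h h' ⊢
  obtain ⟨i, j, rfl, h⟩ := h
  obtain ⟨i', j', rfl, h'⟩ := h'
  refine ⟨i + i', j + j', by push_cast; ring, fun m => ?_⟩
  have e1 : i + i' + m = i + (i' + m) := by omega
  have e2 : j + (i' + m) = i' + (j + m) := by omega
  have e3 : j' + (j + m) = j + j' + m := by omega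
  rw [e1, h, e2, h', e3]

/-- The groupoid structure: `(z, k, z')(z', l, z'') = (z, k + l, z'')` and
`(z, k, z')⁻¹ = (z', -k, z)`; the identities are the arrows `(z, 0, z)`. -/
instance : ArrowGroupoid (CuntzGpd n) where
  d g := ⟨(g.1.2.2, 0, g.1.2.2), exists_unit _⟩
  r g := ⟨(g.1.1, 0, g.1.1), exists_unit _⟩
  inv g := ⟨(g.1.2.2, -g.1.2.1, g.1.1), exists_inv g.2⟩
  comp g h e := ⟨(g.1.1, g.1.2.1 + h.1.2.1, h.1.2.2), by
    have e' : g.1.2.2 = h.1.1 := congrArg (fun t : CuntzGpd n => t.1.1) e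
    have hg := g.2
    have hh := h.2
    exact exists_comp (z := g.1.1) (z' := g.1.2.2) hg (by rw [e']; exact hh)⟩
  d_d _ := rfl
  r_d _ := rfl
  d_r _ := rfl
  r_r _ := rfl
  d_comp _ _ _ := rfl
  r_comp _ _ _ := rfl
  comp_assoc a b c _ _ := Subtype.ext (by simp [add_assoc])
  comp_d a := Subtype.ext (by simp)
  r_comp_self a := Subtype.ext (by simp)
  d_inv _ := rfl
  r_inv _ := rfl
  inv_comp a := Subtype.ext (by simp)
  comp_inv a := Subtype.ext (by simp)

end CuntzGpd

end CuntzGroupoid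

/-!
The groupoid of ultrafilters of any inverse monoid with zero is étale: the sets `V_s` form a base,
`d` is injective on `V_s` because an ultrafilter `A` containing `s` equals `(s d(A))^↑`
(`eq_of_mem_of_d_eq`), and `d` maps `V_s` onto the set of identities containing `s⁻¹ s`
(`exists_mem_d_eq`).

For the isomorphism, a bijective morphism `f` between right ideals covers the set `arrows f` of all
arrows `(x w, |x| - |y|, y w)` with `f(y) = x`. This set depends only on the class of `f` under the
Lenz congruence, because the domain of `f` is finitely generated: whether `f` covers an arrow can be
tested on nonzero elements below a restriction of `f` to a sufficiently long word
(`DistMonoid.arrows_subset_of_lenzRel`). So each element `s` of the Cuntz inverse monoid has a set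
`arrows s`; it is monotone in `s`, compatible with products and inverses, and nonempty unless
`s = 0`. Conversely each arrow `g` yields the set `covering g` of all elements that cover it.

The sets `covering g` are ultrafilters (`isUltrafilter_covering`), different arrows are separated by
some element (`ofArrow_injective`), and every ultrafilter arises from an arrow by compactness of
the space of infinite words (`ofArrow_surjective`). Under this bijection `V_s` corresponds to
`arrows s`, and the sets `arrows s` form a base of the Cuntz groupoid, so that the bijection is a
homeomorphism. As an inclusion between ultrafilters is an equality, it respects domains, ranges,
inverses and products as soon as each of these sets of elements is contained in the expected one,
and this is what compatibility of `arrows` with products and inverses gives.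
-/

namespace CuntzGroupoid

/-! ### Groupoids of ultrafilters are étale -/

section Etale

variable {S : Type*} [InverseMonoidWithZero S]

open ArrowGroupoid Topology

theorem isOpen_ultrafiltersContaining (s : S) : IsOpen (ultrafiltersContaining s) :=
  TopologicalSpace.isOpen_generateFrom_of_mem ⟨s, rfl⟩

/-- A set of ultrafilters is open as soon as membership in it is always witnessed by an element
of the ultrafilter. -/
theorem isOpen_of_forall_mem_exists {U : Set (UltrafilterGroupoid S)}
    (h : ∀ A ∈ U, ∃ s ∈ A.1, ultrafiltersContaining s ⊆ U) : IsOpen U := by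
  refine isOpen_iff_forall_mem_open.2 fun A hA => ?_
  obtain ⟨s, hs, hU⟩ := h A hA
  exact ⟨_, hU, isOpen_ultrafiltersContaining s, hs⟩

theorem isTopologicalBasis_ultrafiltersContaining :
    TopologicalSpace.IsTopologicalBasis
      {U : Set (UltrafilterGroupoid S) | ∃ s : S, U = ultrafiltersContaining s} where
  exists_subset_inter := by
    rintro _ ⟨s, rfl⟩ _ ⟨t, rfl⟩ A ⟨hs, ht⟩
    obtain ⟨c, hc, h1, h2⟩ := A.2.1.1.dir s t hs ht
    exact ⟨_, ⟨c, rfl⟩, hc, fun B hB => ⟨B.2.1.1.up _ _ hB h1, B.2.1.1.up _ _ hB h2⟩⟩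
  sUnion_eq := Set.eq_univ_of_forall fun A =>
    A.2.1.1.nonempty.elim fun s hs => ⟨_, ⟨s, rfl⟩, hs⟩
  eq_generateFrom := rfl

theorem continuous_inv_ultrafilterGroupoid :
    Continuous (inv : UltrafilterGroupoid S → UltrafilterGroupoid S) := by
  refine continuous_generateFrom_iff.2 ?_
  rintro _ ⟨s, rfl⟩
  convert isOpen_ultrafiltersContaining s⁻¹ using 1
  ext A
  exact mem_invSet

theorem continuous_comp_ultrafilterGroupoid :
    Continuous (fun p : {p : UltrafilterGroupoid S × UltrafilterGroupoid S // d p.1 = r p.2} =>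
      comp p.1.1 p.1.2 p.2) := by
  refine continuous_generateFrom_iff.2 ?_
  rintro _ ⟨s, rfl⟩
  refine isOpen_iff_forall_mem_open.2 ?_
  rintro ⟨⟨A, B⟩, hAB⟩ ⟨a, ha, b, hb, h⟩
  refine ⟨Subtype.val ⁻¹' (ultrafiltersContaining a ×ˢ ultrafiltersContaining b), ?_, ?_, ha, hb⟩
  · rintro ⟨⟨A', B'⟩, h'⟩ ⟨ha', hb'⟩
    exact ⟨a, ha', b, hb', h⟩
  · exact ((isOpen_ultrafiltersContaining a).prod
      (isOpen_ultrafiltersContaining b)).preimage continuous_subtype_val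

theorem continuous_d_ultrafilterGroupoid :
    Continuous (d : UltrafilterGroupoid S → UltrafilterGroupoid S) := by
  refine continuous_generateFrom_iff.2 ?_
  rintro _ ⟨s, rfl⟩
  refine isOpen_of_forall_mem_exists fun A hA => ?_
  obtain ⟨a, ha, h⟩ := (mem_dSet A.2.1.1).1 hA
  exact ⟨a, ha, fun B hB => (mem_dSet B.2.1.1).2 ⟨a, hB, h⟩⟩

/-- An ultrafilter is determined by its domain and any one of its elements. -/
theorem eq_of_mem_of_d_eq {A B : UltrafilterGroupoid S} {s : S} (hA : s ∈ A.1) (hB : s ∈ B.1)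
    (h : d A = d B) : A = B := by
  have h' : dSet A.1 = dSet B.1 := congrArg Subtype.val h
  refine ultrafilter_eq_of_subset fun a ha => ?_
  obtain ⟨c, hc, h1, h2⟩ := A.2.1.1.dir s a hA ha
  have h3 : c⁻¹ * c ∈ dSet B.1 := h' ▸ (mem_dSet A.2.1.1).2 ⟨c, hc, natLE_refl _⟩
  have h4 := mul_mem_of_mem_dSet B.2.1.1 hB h3
  rw [← h1.eq_mul] at h4
  exact B.2.1.1.up c a h4 h2

/-- Every identity `E` containing `s⁻¹ s` is the domain of an ultrafilter containing `s`, namely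
of `(s E)^↑`. -/
theorem exists_mem_d_eq {E : UltrafilterGroupoid S} (hE : d E = E) {s : S}
    (hs : s⁻¹ * s ∈ E.1) : ∃ A : UltrafilterGroupoid S, s ∈ A.1 ∧ d A = E := by
  have hEd : dSet E.1 = E.1 := congrArg Subtype.val hE
  have hEf := E.2.1.1
  have hPf : IsFilter {b : S | NatLE s b} :=
    ⟨⟨s, natLE_refl s⟩, fun _ _ h h' => h.trans h', fun _ _ h h' => ⟨s, natLE_refl s, h, h'⟩⟩
  set A : Set S := upMul {b : S | NatLE s b} E.1 with hA
  have hAp : IsProperFilter A := by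
    refine ⟨isFilter_upMul hPf hEf, ?_⟩
    rintro ⟨b, hb, e, he, h⟩
    have h0 : s * e = 0 := ((NatLE.mul_right hb e).trans h).eq_zero
    have h1 : s⁻¹ * s * e ∈ E.1 := mul_mem_of_mem_dSet hEf hs (hEd.symm ▸ he)
    rw [mul_assoc, h0, mul_zero] at h1
    exact E.2.1.2 h1
  have hEA : E.1 ⊆ dSet A := by
    conv_lhs => rw [← hEd]
    exact dSet_subset_dSet_upMul hPf hEf
  have hAd : E.1 = dSet A := E.2.2 _ hAp.dSet hEA
  refine ⟨⟨A, hAp, fun C hC hAC => eq_of_subset_of_dSet_eq hAp.1 hC.1 hAC ?_⟩, ?_, ?_⟩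
  · rw [← hAd, ← E.2.2 _ hC.dSet (hEA.trans (dSet_mono hAC))]
  · refine ⟨s, natLE_refl s, _, hs, ?_⟩
    rw [← mul_assoc, InverseMonoidWithZero.mul_inv_mul]
    exact natLE_refl s
  · exact Subtype.ext hAd.symm

/-- The domain map is injective on `V_s` and open, as it maps `V_s` onto the set of all identities
that contain `s⁻¹ s`. -/
theorem isLocalHomeomorph_d_ultrafilterGroupoid :
    IsLocalHomeomorph (fun A : UltrafilterGroupoid S =>
      (⟨d A, d_d A⟩ : {E : UltrafilterGroupoid S // d E = E})) := by
  have hopen : IsOpenMap (fun A : UltrafilterGroupoid S =>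
      (⟨d A, d_d A⟩ : {E : UltrafilterGroupoid S // d E = E})) := by
    refine isTopologicalBasis_ultrafiltersContaining.isOpenMap_iff.2 ?_
    rintro _ ⟨s, rfl⟩
    convert (isOpen_ultrafiltersContaining (s⁻¹ * s)).preimage continuous_subtype_val using 1
    ext ⟨E, hE⟩
    constructor
    · rintro ⟨A, hA, h⟩
      obtain rfl : d A = E := congrArg Subtype.val h
      exact (mem_dSet A.2.1.1).2 ⟨s, hA, natLE_refl _⟩
    · intro h
      obtain ⟨A, hA, hd⟩ := exists_mem_d_eq hE h
      exact ⟨A, hA, Subtype.ext hd⟩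
  refine isLocalHomeomorph_iff_isOpenEmbedding_restrict.2 fun A => ?_
  obtain ⟨s, hs⟩ := A.2.1.1.nonempty
  have hU := isOpen_ultrafiltersContaining s
  refine ⟨ultrafiltersContaining s, hU.mem_nhds hs,
    IsOpenEmbedding.of_continuous_injective_isOpenMap ?_ ?_ (hopen.comp hU.isOpenMap_subtype_val)⟩
  · exact (continuous_d_ultrafilterGroupoid.subtype_mk _).comp continuous_subtype_val
  · intro B C h
    exact Subtype.ext (eq_of_mem_of_d_eq B.2 C.2 (congrArg Subtype.val h))

variable (S) in
theorem isEtaleGroupoid_ultrafilterGroupoid : IsEtaleGroupoid (UltrafilterGroupoid S) where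
  continuous_inv := continuous_inv_ultrafilterGroupoid
  continuous_comp := continuous_comp_ultrafilterGroupoid
  isLocalHomeomorph_d := isLocalHomeomorph_d_ultrafilterGroupoid

end Etale

/-! ### Finite prefixes of infinite words -/

section Words

variable {n : ℕ}

open CuntzGpd (prepend_add eq_prepend)

theorem prepend_apply_of_lt (x : Words n) (w : InfWords n) {k : ℕ} (hk : k < x.length) :
    prepend x w k = x.toList[k] := dif_pos hk

theorem prepend_one (w : InfWords n) : prepend 1 w = w := by
  funext k
  simp [prepend]

theorem prepend_mul (x u : Words n) (w : InfWords n) :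
    prepend (x * u) w = prepend x (prepend u w) := by
  funext k
  simp only [prepend, FreeMonoid.toList_mul, List.length_append, List.getElem_append]
  split_ifs <;> first | rfl | omega | (congr 1; omega)

theorem prepend_injective (x : Words n) : Function.Injective (prepend x) := by
  intro w w' h
  funext m
  rw [← prepend_add x w, h, prepend_add]

/-- Of two prefixes of an infinite word, the longer one extends the shorter one. -/
theorem exists_mul_of_prepend_eq {x x' : Words n} {w w' : InfWords n}
    (h : prepend x w = prepend x' w') (hl : x.length ≤ x'.length) :
    ∃ u : Words n, x' = x * u ∧ w = prepend u w' := by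
  have hx : x.toList <+: x'.toList := by
    rw [List.prefix_iff_getElem]
    refine ⟨hl, fun i hi => ?_⟩
    have := congrFun h i
    rwa [prepend_apply_of_lt x w hi, prepend_apply_of_lt x' w' (lt_of_lt_of_le hi hl)] at this
  obtain ⟨u, hu⟩ := hx
  have hx' : x' = x * FreeMonoid.ofList u := hu.symm
  refine ⟨_, hx', prepend_injective x ?_⟩
  rw [h, hx', prepend_mul]

/-- Two prefixes of the same length of an infinite word are equal. -/
theorem eq_of_prepend_eq {u u' : Words n} {w w' : InfWords n}
    (h : prepend u w = prepend u' w') (hl : u.length = u'.length) : u = u' := by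
  obtain ⟨v, rfl, -⟩ := exists_mul_of_prepend_eq h hl.le
  rw [FreeMonoid.length_mul] at hl
  rw [FreeMonoid.length_eq_zero.1 (show v.length = 0 by omega), mul_one]

/-- Every infinite word has a prefix of each length. -/
theorem exists_eq_prepend (w : InfWords n) (N : ℕ) :
    ∃ (u : Words n) (w' : InfWords n), u.length = N ∧ w = prepend u w' :=
  have ⟨u, hu, h⟩ := eq_prepend w (fun m => w (N + m)) N fun _ => rfl
  ⟨u, _, hu, h⟩

theorem continuous_prepend (x : Words n) : Continuous (prepend x) := by
  refine continuous_pi fun k => ?_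
  unfold prepend
  split_ifs
  · exact continuous_const
  · exact continuous_apply _

/-- The cylinders `u A_n^ω` form a neighbourhood base of the infinite words. -/
theorem exists_prepend_mem_of_isOpen {V : Set (InfWords n)} (hV : IsOpen V) {w : InfWords n}
    (hw : w ∈ V) : ∃ (u : Words n) (w' : InfWords n), w = prepend u w' ∧
      ∀ v, prepend u v ∈ V := by
  obtain ⟨_, ⟨z, N, rfl⟩, hwz, hz⟩ :=
    (PiNat.isTopologicalBasis_cylinders (fun _ => Fin n)).exists_subset_of_mem_open hw hV
  obtain ⟨u, w', hu, rfl⟩ := exists_eq_prepend w N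
  refine ⟨u, w', rfl, fun v => hz fun i hi => ?_⟩
  rw [← hwz i hi, prepend_apply_of_lt _ _ (hu ▸ hi), prepend_apply_of_lt _ _ (hu ▸ hi)]

namespace CuntzGpd

theorem mk_prepend (x y u : Words n) (w : InfWords n) :
    mk x y (prepend u w) = mk (x * u) (y * u) w := by
  apply Subtype.ext
  simp [mk, prepend_mul, FreeMonoid.length_mul]

theorem exists_eq_mk (g : CuntzGpd n) : ∃ (x y : Words n) (w : InfWords n), g = mk x y w :=
  have ⟨x, y, w, h⟩ := g.2
  ⟨x, y, w, Subtype.ext h⟩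

/-- Of two presentations `(x w, |x| - |y|, y w)` of an arrow, the one with the longer words arises
from the other by moving a prefix `u` of `w` into `x` and `y`. -/
theorem exists_mul_of_mk_eq {x y x' y' : Words n} {w w' : InfWords n}
    (h : mk x y w = mk x' y' w') (hl : y.length ≤ y'.length) :
    ∃ u : Words n, x' = x * u ∧ y' = y * u ∧ w = prepend u w' := by
  have h0 := congrArg Subtype.val h
  simp only [mk, Prod.mk.injEq] at h0
  obtain ⟨h1, h2, h3⟩ := h0
  obtain ⟨u, hu, hw⟩ := exists_mul_of_prepend_eq h3 hl
  obtain ⟨v, hv, hw'⟩ := exists_mul_of_prepend_eq h1 (by omega)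
  subst hu hv
  simp only [FreeMonoid.length_mul] at h2
  obtain rfl := eq_of_prepend_eq (hw'.symm.trans hw) (by push_cast at h2; omega)
  exact ⟨v, rfl, rfl, hw⟩

theorem mk_injective (x y : Words n) : Function.Injective (mk x y) := by
  intro w w' h
  obtain ⟨u, -, hu, hw⟩ := exists_mul_of_mk_eq h le_rfl
  rw [left_eq_mul.1 hu, prepend_one] at hw
  exact hw

end CuntzGpd

end Words

/-! ### The arrows covered by a morphism -/

namespace DistMonoid

variable {n : ℕ}

open CuntzGpd (exists_mul_of_mk_eq mk_prepend)

theorem eq_some_of_natLE {f g : DistMonoid n} (h : NatLE f g) {y x : Words n}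
    (hf : f.toPEquiv y = some x) : g.toPEquiv y = some x := by
  rw [h.eq_mul, toPEquiv_mul, PEquiv.trans_eq_some] at hf
  obtain ⟨z, hz, hg⟩ := hf
  have := (mul_inv_eq_some f⁻¹ y z).1 hz
  rwa [this.1]

theorem natLE_of_forall_eq_some {f g : DistMonoid n}
    (h : ∀ y x, f.toPEquiv y = some x → g.toPEquiv y = some x) : NatLE f g := by
  have hfg : f = g * (f⁻¹ * f) := by
    refine DistMonoid.ext (PEquiv.ext fun y => Option.ext fun x => ?_)
    rw [toPEquiv_mul, PEquiv.trans_eq_some]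
    constructor
    · intro hf
      exact ⟨y, (mul_inv_eq_some f⁻¹ y y).2 ⟨rfl, x, (PEquiv.eq_some_iff _).2 hf⟩, h y x hf⟩
    · rintro ⟨z, hz, hg⟩
      obtain ⟨rfl, u, hu⟩ := (mul_inv_eq_some f⁻¹ y z).1 hz
      have hu' : f.toPEquiv y = some u := (PEquiv.eq_some_iff _).1 hu
      rwa [← hg, h y u hu']
  rwa [← mul_assoc] at hfg

theorem exists_eq_some_of_ne_zero {f : DistMonoid n} (hf : f ≠ 0) :
    ∃ y x, f.toPEquiv y = some x := by
  by_contra! h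
  refine hf (DistMonoid.ext (PEquiv.ext fun y => ?_))
  exact Option.eq_none_iff_forall_ne_some.2 fun x => h y x

/-- The word `w` with its prefix `y` replaced by `x`, if `y` is a prefix of `w`. -/
def replacePrefix (x y w : Words n) : Option (Words n) :=
  if y.toList <+: w.toList then some (x * FreeMonoid.ofList (w.toList.drop y.length)) else none

theorem replacePrefix_eq_some {x y w v : Words n} :
    replacePrefix x y w = some v ↔ ∃ s, w = y * s ∧ v = x * s := by
  unfold replacePrefix
  constructor
  · intro h
    split_ifs at h with hp
    obtain ⟨s, hs⟩ := hp
    refine ⟨FreeMonoid.ofList s, hs.symm, ?_⟩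
    rw [← Option.some.inj h, ← hs]
    simp [FreeMonoid.length]
  · rintro ⟨s, rfl, rfl⟩
    simp [FreeMonoid.length]

/-- The bijective morphism `y s ↦ x s` from `y A_n^*` to `x A_n^*`. -/
def single (x y : Words n) : DistMonoid n where
  toPEquiv :=
    { toFun := replacePrefix x y
      invFun := replacePrefix y x
      inv := fun a b => by
        simp only [replacePrefix_eq_some]
        exact exists_congr fun s => and_comm }
  fg_dom := ⟨{y}, Set.finite_singleton _, by
    ext w; simp [Option.isSome_iff_exists, replacePrefix_eq_some]⟩
  fg_ran := ⟨{x}, Set.finite_singleton _, by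
    ext w; simp [Option.isSome_iff_exists, replacePrefix_eq_some, PEquiv.symm]⟩
  map_mul w v s h := by
    simp only [PEquiv.coe_mk, replacePrefix_eq_some] at h ⊢
    obtain ⟨t, rfl, rfl⟩ := h
    exact ⟨t * s, mul_assoc _ _ _, mul_assoc _ _ _⟩

theorem single_eq_some {x y w v : Words n} :
    (single x y).toPEquiv w = some v ↔ ∃ s, w = y * s ∧ v = x * s := replacePrefix_eq_some

theorem single_self (x y : Words n) : (single x y).toPEquiv y = some x :=
  single_eq_some.2 ⟨1, (mul_one _).symm, (mul_one _).symm⟩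

theorem single_natLE {f : DistMonoid n} {x y : Words n} (h : f.toPEquiv y = some x) :
    NatLE (single x y) f := by
  refine natLE_of_forall_eq_some fun w v hw => ?_
  obtain ⟨s, rfl, rfl⟩ := single_eq_some.1 hw
  exact f.map_mul _ _ _ h

theorem single_ne_zero (x y : Words n) : single x y ≠ 0 := fun h => by
  have h1 := single_self x y
  rw [h] at h1
  cases h1

/-- Because the domain of `f` is finitely generated, a value of `f` at an extension of a
sufficiently long word `y` comes from a value of `f` at `y`. -/
theorem exists_length_bound (f : DistMonoid n) : ∃ N : ℕ, ∀ y x u : Words n, N ≤ y.length →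
    f.toPEquiv (y * u) = some (x * u) → f.toPEquiv y = some x := by
  obtain ⟨X, hX, hdom⟩ := f.fg_dom
  obtain ⟨N, hN⟩ := (hX.image FreeMonoid.length).bddAbove
  refine ⟨N, fun y x u hy h => ?_⟩
  have hmem : y * u ∈ {w | (f.toPEquiv w).isSome} := Option.isSome_iff_exists.2 ⟨_, h⟩
  rw [hdom] at hmem
  obtain ⟨c, hc, s, hs⟩ := hmem
  have hcN : c.length ≤ y.length := (hN ⟨c, hc, rfl⟩).trans hy
  obtain ⟨t, ht⟩ : c.toList <+: y.toList :=
    List.prefix_of_prefix_length_le ⟨s.toList, (congrArg FreeMonoid.toList hs).symm⟩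
      ⟨u.toList, rfl⟩ hcN
  have hymem : y ∈ {w | (f.toPEquiv w).isSome} := by
    rw [hdom]
    exact ⟨c, hc, FreeMonoid.ofList t, ht.symm⟩
  obtain ⟨z, hz⟩ := Option.isSome_iff_exists.1 hymem
  have h1 := f.map_mul _ _ u hz
  rw [h] at h1
  rw [hz, mul_right_cancel (Option.some.inj h1)]

/-- The set of arrows `(x w, |x| - |y|, y w)` with `f(y) = x`, a compact open bisection of the
Cuntz groupoid. -/
def arrows (f : DistMonoid n) : Set (CuntzGpd n) :=
  {g | ∃ x y w, f.toPEquiv y = some x ∧ g = CuntzGpd.mk x y w}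

theorem mk_mem_arrows_single (x y : Words n) (w : InfWords n) :
    CuntzGpd.mk x y w ∈ (single x y).arrows :=
  ⟨x, y, w, single_self x y, rfl⟩

theorem arrows_single (x y : Words n) : (single x y).arrows = Set.range (CuntzGpd.mk x y) := by
  ext g
  constructor
  · rintro ⟨x', y', w, h, rfl⟩
    obtain ⟨s, rfl, rfl⟩ := single_eq_some.1 h
    exact ⟨_, mk_prepend x y s w⟩
  · rintro ⟨w, rfl⟩
    exact mk_mem_arrows_single x y w

/-- If `f` covers one arrow presented by `x` and a sufficiently long word `y`, then `f(y) = x`, and so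
`f` covers all arrows presented by `x` and `y`. -/
theorem exists_eq_some_of_mk_mem_arrows (f : DistMonoid n) :
    ∃ N : ℕ, ∀ (y x : Words n) (w : InfWords n),
    N ≤ y.length → CuntzGpd.mk x y w ∈ f.arrows → f.toPEquiv y = some x := by
  obtain ⟨N, hN⟩ := f.exists_length_bound
  refine ⟨N, ?_⟩
  rintro y x w hy ⟨b, a, c, hf, h⟩
  rcases le_total y.length a.length with hl | hl
  · obtain ⟨u, rfl, rfl, -⟩ := exists_mul_of_mk_eq h hl
    exact hN y x u hy hf
  · obtain ⟨u, rfl, rfl, -⟩ := exists_mul_of_mk_eq h.symm hl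
    exact f.map_mul _ _ _ hf

theorem arrows_nonempty (hn : 0 < n) {f : DistMonoid n} (hf : f ≠ 0) : f.arrows.Nonempty := by
  obtain ⟨y, x, h⟩ := exists_eq_some_of_ne_zero hf
  exact ⟨_, x, y, fun _ => ⟨0, hn⟩, h, rfl⟩

theorem arrows_subset_of_natLE {f g : DistMonoid n} (h : NatLE f g) : f.arrows ⊆ g.arrows := by
  rintro _ ⟨x, y, w, hf, rfl⟩
  exact ⟨x, y, w, eq_some_of_natLE h hf, rfl⟩

/-- Congruent morphisms cover the same arrows. For an arrow covered by `f`, a nonzero element below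
both `g` and the restriction of `f` to a long word shows that `g` agrees with `f` on an extension of
that word, hence on the word itself. -/
theorem arrows_subset_of_lenzRel {f g : DistMonoid n} (h : LenzRel f g) :
    f.arrows ⊆ g.arrows := by
  rintro _ ⟨x, y, w, hf, rfl⟩
  obtain ⟨N, hN⟩ := g.exists_length_bound
  obtain ⟨u, w', hu, rfl⟩ := exists_eq_prepend w N
  obtain ⟨z, hz, hzs, hzg⟩ := h.1 (single (x * u) (y * u)) (single_ne_zero _ _)
    (single_natLE (f.map_mul _ _ _ hf))
  obtain ⟨a, b, hab⟩ := exists_eq_some_of_ne_zero hz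
  obtain ⟨s, rfl, rfl⟩ := single_eq_some.1 (eq_some_of_natLE hzs hab)
  refine ⟨x * u, y * u, w', hN _ _ s ?_ (eq_some_of_natLE hzg hab), mk_prepend x y u w'⟩
  rw [FreeMonoid.length_mul]
  omega

theorem inv_mem_arrows {f : DistMonoid n} {g : CuntzGpd n} (hg : g ∈ f.arrows) :
    ArrowGroupoid.inv g ∈ (f⁻¹).arrows := by
  obtain ⟨x, y, w, hf, rfl⟩ := hg
  exact ⟨y, x, w, (PEquiv.eq_some_iff _).2 hf,
    Subtype.ext (by simp [CuntzGpd.mk, ArrowGroupoid.inv])⟩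

/-- Two arrows with the same source that are covered by the same morphism agree. -/
theorem eq_of_mem_arrows {f : DistMonoid n} {g h : CuntzGpd n} (hg : g ∈ f.arrows)
    (hh : h ∈ f.arrows) (e : g.1.2.2 = h.1.2.2) : g = h := by
  obtain ⟨x, y, w, hf, rfl⟩ := hg
  obtain ⟨x', y', w', hf', rfl⟩ := hh
  wlog hl : y.length ≤ y'.length generalizing x y w x' y' w'
  · exact (this x' y' w' hf' x y w hf e.symm (le_of_not_ge hl)).symm
  obtain ⟨u, rfl, rfl⟩ := exists_mul_of_prepend_eq e hl
  have := f.map_mul _ _ u hf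
  rw [hf'] at this
  rw [Option.some.inj this, mk_prepend]

theorem comp_mem_arrows {f f' : DistMonoid n} {g h : CuntzGpd n} (hg : g ∈ f.arrows)
    (hh : h ∈ f'.arrows) (e : ArrowGroupoid.d g = ArrowGroupoid.r h) :
    ArrowGroupoid.comp g h e ∈ (f * f').arrows := by
  obtain ⟨x, y, w, hf, rfl⟩ := hg
  obtain ⟨x', y', w', hf', rfl⟩ := hh
  have e' : prepend y w = prepend x' w' := congrArg (fun t : CuntzGpd n => t.1.1) e
  rcases le_total y.length x'.length with hl | hl
  · obtain ⟨u, rfl, rfl⟩ := exists_mul_of_prepend_eq e' hl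
    refine ⟨x * u, y', w', ?_, Subtype.ext ?_⟩
    · rw [toPEquiv_mul, PEquiv.trans_eq_some]
      exact ⟨_, hf', f.map_mul _ _ _ hf⟩
    · simp [CuntzGpd.mk, ArrowGroupoid.comp, prepend_mul, FreeMonoid.length_mul]
      ring
  · obtain ⟨u, rfl, rfl⟩ := exists_mul_of_prepend_eq e'.symm hl
    refine ⟨x, y' * u, w, ?_, Subtype.ext ?_⟩
    · rw [toPEquiv_mul, PEquiv.trans_eq_some]
      exact ⟨_, f'.map_mul _ _ _ hf', hf⟩
    · simp [CuntzGpd.mk, ArrowGroupoid.comp, prepend_mul, FreeMonoid.length_mul]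
      ring

theorem isOpen_arrows (f : DistMonoid n) : IsOpen f.arrows := by
  have : f.arrows = ⋃ (y) (x) (_ : f.toPEquiv y = some x), CuntzGpd.basicOpen x y Set.univ := by
    ext g
    simp only [arrows, CuntzGpd.basicOpen, Set.mem_iUnion, Set.mem_univ, true_and]
    exact ⟨fun ⟨x, y, w, h, e⟩ => ⟨y, x, h, w, e⟩, fun ⟨y, x, h, w, e⟩ => ⟨x, y, w, h, e⟩⟩
  rw [this]
  exact isOpen_iUnion fun y => isOpen_iUnion fun x => isOpen_iUnion fun _ =>
    TopologicalSpace.isOpen_generateFrom_of_mem ⟨x, y, _, isOpen_univ, rfl⟩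

/-- The sources of the arrows covered by `f` are the infinite words with a prefix among the
finitely many generators of the domain of `f`. -/
theorem isClosed_source_arrows (f : DistMonoid n) :
    IsClosed ((fun g : CuntzGpd n => g.1.2.2) '' f.arrows) := by
  obtain ⟨X, hX, hdom⟩ := f.fg_dom
  have : (fun g : CuntzGpd n => g.1.2.2) '' f.arrows = ⋃ y ∈ X, Set.range (prepend y) := by
    ext z
    simp only [Set.mem_iUnion, Set.mem_image, Set.mem_range, exists_prop]
    constructor
    · rintro ⟨_, ⟨x, y, w, hf, rfl⟩, rfl⟩
      have hy : y ∈ {w | (f.toPEquiv w).isSome} := Option.isSome_iff_exists.2 ⟨x, hf⟩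
      rw [hdom] at hy
      obtain ⟨c, hc, s, rfl⟩ := hy
      exact ⟨c, hc, prepend s w, (prepend_mul c s w).symm⟩
    · rintro ⟨y, hy, w, rfl⟩
      have hy' : y ∈ {w | (f.toPEquiv w).isSome} := by
        rw [hdom]
        exact ⟨y, hy, 1, (mul_one y).symm⟩
      obtain ⟨x, hx⟩ := Option.isSome_iff_exists.1 hy'
      exact ⟨CuntzGpd.mk x y w, ⟨x, y, w, hx, rfl⟩, rfl⟩
  rw [this]
  exact hX.isClosed_biUnion fun y _ => (isCompact_range (continuous_prepend y)).isClosed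

end DistMonoid

/-! ### Ultrafilters of the Cuntz inverse monoid -/

theorem LenzQuotient.exists_eq_mk {S : Type*} [InverseMonoidWithZero S] (s : LenzQuotient S) :
    ∃ a : S, s = LenzQuotient.mk a :=
  LenzQuotient.ind (p := fun s => ∃ a : S, s = LenzQuotient.mk a) (fun a => ⟨a, rfl⟩) s

namespace CuntzInverseMonoid

variable {n : ℕ}

open ArrowGroupoid CuntzGpd
open DistMonoid (single)

/-- The arrows covered by an element of the Cuntz inverse monoid: those covered by any of the
morphisms in the class. -/
def arrows (s : CuntzInverseMonoid n) : Set (CuntzGpd n) :=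
  Con.liftOn (c := lenzCon (DistMonoid n)) s DistMonoid.arrows fun _ _ h =>
    (DistMonoid.arrows_subset_of_lenzRel h).antisymm
      (DistMonoid.arrows_subset_of_lenzRel (LenzRel.symm h))

theorem arrows_mk (f : DistMonoid n) : arrows (LenzQuotient.mk f) = f.arrows := rfl

theorem mk_natLE_mk {f g : DistMonoid n} (h : NatLE f g) :
    NatLE (LenzQuotient.mk f) (LenzQuotient.mk g) :=
  congrArg LenzQuotient.mk h

theorem arrows_subset_of_natLE {s t : CuntzInverseMonoid n} (h : NatLE s t) :
    arrows s ⊆ arrows t := by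
  obtain ⟨a, rfl⟩ := LenzQuotient.exists_eq_mk s
  obtain ⟨b, rfl⟩ := LenzQuotient.exists_eq_mk t
  have h' : LenzQuotient.mk a = LenzQuotient.mk (b * (a⁻¹ * a)) := h.eq_mul
  rw [h', arrows_mk]
  exact DistMonoid.arrows_subset_of_natLE (mul_idem_natLE (inv_mul_idem a) b)

theorem arrows_zero : arrows (0 : CuntzInverseMonoid n) = ∅ := by
  refine Set.eq_empty_of_forall_notMem ?_
  rintro _ ⟨x, y, w, h, -⟩
  cases h

theorem arrows_nonempty (hn : 0 < n) {s : CuntzInverseMonoid n} (hs : s ≠ 0) :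
    (arrows s).Nonempty := by
  obtain ⟨f, rfl⟩ := LenzQuotient.exists_eq_mk s
  exact DistMonoid.arrows_nonempty hn fun h => hs (congrArg LenzQuotient.mk h)

theorem inv_mem_arrows {s : CuntzInverseMonoid n} {g : CuntzGpd n} :
    g ∈ arrows s → inv g ∈ arrows s⁻¹ := by
  obtain ⟨f, rfl⟩ := LenzQuotient.exists_eq_mk s
  exact DistMonoid.inv_mem_arrows

theorem comp_mem_arrows {s t : CuntzInverseMonoid n} {g h : CuntzGpd n} (e : d g = r h) :
    g ∈ arrows s → h ∈ arrows t → comp g h e ∈ arrows (s * t) := by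
  obtain ⟨f, rfl⟩ := LenzQuotient.exists_eq_mk s
  obtain ⟨f', rfl⟩ := LenzQuotient.exists_eq_mk t
  exact fun hg hh => DistMonoid.comp_mem_arrows hg hh e

theorem isOpen_arrows (s : CuntzInverseMonoid n) : IsOpen (arrows s) := by
  obtain ⟨f, rfl⟩ := LenzQuotient.exists_eq_mk s
  exact f.isOpen_arrows

theorem isClosed_source_arrows (s : CuntzInverseMonoid n) :
    IsClosed ((fun g : CuntzGpd n => g.1.2.2) '' arrows s) := by
  obtain ⟨f, rfl⟩ := LenzQuotient.exists_eq_mk s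
  exact f.isClosed_source_arrows

theorem eq_of_mem_arrows {s : CuntzInverseMonoid n} {g h : CuntzGpd n} :
    g ∈ arrows s → h ∈ arrows s → g.1.2.2 = h.1.2.2 → g = h := by
  obtain ⟨f, rfl⟩ := LenzQuotient.exists_eq_mk s
  exact DistMonoid.eq_of_mem_arrows

/-- The elements that cover the arrow `g`. -/
def covering (g : CuntzGpd n) : Set (CuntzInverseMonoid n) := {s | g ∈ arrows s}

theorem mk_single_mem_covering (x y : Words n) (w : InfWords n) :
    LenzQuotient.mk (single x y) ∈ covering (CuntzGpd.mk x y w) :=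
  DistMonoid.mk_mem_arrows_single x y w

/-- Of two morphisms that cover `g`, a common lower bound covering `g` is `single x y`, where `g` is
presented by the longer of the two pairs of words. -/
theorem isFilter_covering (g : CuntzGpd n) : IsFilter (covering g) where
  nonempty := by
    obtain ⟨x, y, w, rfl⟩ := exists_eq_mk g
    exact ⟨_, mk_single_mem_covering x y w⟩
  up s t hs h := arrows_subset_of_natLE h hs
  dir := by
    intro s t
    obtain ⟨f, rfl⟩ := LenzQuotient.exists_eq_mk s
    obtain ⟨f', rfl⟩ := LenzQuotient.exists_eq_mk t
    rintro ⟨x, y, w, hf, rfl⟩ ⟨x', y', w', hf', e⟩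
    rcases le_total y.length y'.length with hl | hl
    · obtain ⟨u, rfl, rfl, -⟩ := exists_mul_of_mk_eq e hl
      exact ⟨_, e ▸ mk_single_mem_covering _ _ w',
        mk_natLE_mk (DistMonoid.single_natLE (f.map_mul _ _ _ hf)),
        mk_natLE_mk (DistMonoid.single_natLE hf')⟩
    · obtain ⟨u, rfl, rfl, -⟩ := exists_mul_of_mk_eq e.symm hl
      exact ⟨_, mk_single_mem_covering _ _ w,
        mk_natLE_mk (DistMonoid.single_natLE hf),
        mk_natLE_mk (DistMonoid.single_natLE (f'.map_mul _ _ _ hf'))⟩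

theorem isProperFilter_covering (g : CuntzGpd n) : IsProperFilter (covering g) :=
  ⟨isFilter_covering g, fun h => by
    have h' : g ∈ arrows (0 : CuntzInverseMonoid n) := h
    rwa [arrows_zero] at h'⟩

/-- A proper filter `B` containing every element that covers `g` contains no other element. Indeed,
present `g` by words `x u` and `y u` with `u` long. A nonzero lower bound of `s ∈ B` and of the class
of `y u v ↦ x u v` gives an arrow covered by `s` that is also presented by `x u` and `y u`, so that
`s` covers `g` too. -/
theorem isUltrafilter_covering (hn : 0 < n) (g : CuntzGpd n) : IsUltrafilter (covering g) := by
  refine ⟨isProperFilter_covering g, fun B hB hgB => hgB.antisymm fun s => ?_⟩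
  obtain ⟨f, rfl⟩ := LenzQuotient.exists_eq_mk s
  intro hf
  obtain ⟨x, y, w, rfl⟩ := exists_eq_mk g
  obtain ⟨N, hN⟩ := f.exists_eq_some_of_mk_mem_arrows
  obtain ⟨u, w, hu, rfl⟩ := exists_eq_prepend w N
  rw [mk_prepend] at hgB ⊢
  obtain ⟨c, hc, h1, h2⟩ := hB.1.dir _ _ hf (hgB (mk_single_mem_covering _ _ w))
  obtain ⟨h, hh⟩ := arrows_nonempty hn fun h0 => hB.2 (h0 ▸ hc)
  have h3 := arrows_subset_of_natLE h2 hh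
  rw [arrows_mk, DistMonoid.arrows_single] at h3
  obtain ⟨v, rfl⟩ := h3
  refine ⟨_, _, w, hN _ _ v ?_ (arrows_subset_of_natLE h1 hh), rfl⟩
  rw [FreeMonoid.length_mul]
  omega

/-- The ultrafilter of all elements that cover the arrow `g`. -/
def ofArrow (hn : 0 < n) (g : CuntzGpd n) : UltrafilterGroupoid (CuntzInverseMonoid n) :=
  ⟨covering g, isUltrafilter_covering hn g⟩

/-- The sets `arrows s` refine the base of the topology of the Cuntz groupoid; the element `s` may be
taken to be the class of a morphism `y u v ↦ x u v`. -/
theorem exists_arrows_subset_basicOpen {x y : Words n} {V : Set (InfWords n)} (hV : IsOpen V)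
    {g : CuntzGpd n} (hg : g ∈ basicOpen x y V) :
    ∃ s : CuntzInverseMonoid n, g ∈ arrows s ∧ arrows s ⊆ basicOpen x y V := by
  obtain ⟨w, hw, rfl⟩ := hg
  obtain ⟨u, w', rfl, hu⟩ := exists_prepend_mem_of_isOpen hV hw
  refine ⟨LenzQuotient.mk (single (x * u) (y * u)), ?_, ?_⟩
  · rw [mk_prepend]
    exact mk_single_mem_covering _ _ w'
  · rw [arrows_mk, DistMonoid.arrows_single]
    rintro _ ⟨v, rfl⟩
    exact ⟨prepend u v, hu v, (mk_prepend x y u v).symm⟩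

theorem ofArrow_injective (hn : 0 < n) : Function.Injective (ofArrow (n := n) hn) := by
  intro g g' h
  have h' : covering g = covering g' := congrArg Subtype.val h
  obtain ⟨x, y, w, rfl⟩ := exists_eq_mk g
  have key : ∀ V : Set (InfWords n), IsOpen V → w ∈ V → g' ∈ basicOpen x y V := by
    intro V hV hw
    obtain ⟨s, hs, hsV⟩ := exists_arrows_subset_basicOpen (x := x) (y := y) hV ⟨w, hw, rfl⟩
    have hs' : s ∈ covering g' := h' ▸ hs
    exact hsV hs'
  obtain ⟨w', -, rfl⟩ := key Set.univ isOpen_univ trivial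
  by_contra hne
  have hw : w ≠ w' := fun e => hne (by rw [e])
  obtain ⟨v, hv, e⟩ := key {w'}ᶜ isOpen_compl_singleton hw
  exact hv (mk_injective x y e).symm

/-- By compactness of the space of infinite words, the arrows covered by the elements of an
ultrafilter `A` have a common source; inside the bisection of a fixed element of `A` that source
determines an arrow, which is covered by all elements of `A`. -/
theorem ofArrow_surjective (hn : 0 < n) : Function.Surjective (ofArrow (n := n) hn) := by
  intro A
  have hA := A.2.1.1
  have hne : ∀ s ∈ A.1, (arrows s).Nonempty := fun s hs =>
    arrows_nonempty hn fun h0 => A.2.1.2 (h0 ▸ hs)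
  have : Nonempty A.1 := hA.nonempty.to_subtype
  obtain ⟨z, hz⟩ := IsCompact.nonempty_iInter_of_directed_nonempty_isCompact_isClosed
    (fun s : A.1 => (fun g : CuntzGpd n => g.1.2.2) '' arrows s.1)
    (fun s t => by
      obtain ⟨c, hc, h1, h2⟩ := hA.dir s.1 t.1 s.2 t.2
      exact ⟨⟨c, hc⟩, Set.image_mono (arrows_subset_of_natLE h1),
        Set.image_mono (arrows_subset_of_natLE h2)⟩)
    (fun s => (hne s.1 s.2).image _)
    (fun s => (isClosed_source_arrows s.1).isCompact)
    (fun s => isClosed_source_arrows s.1)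
  rw [Set.mem_iInter] at hz
  obtain ⟨s, hs⟩ := hA.nonempty
  obtain ⟨g, hg, rfl⟩ := hz ⟨s, hs⟩
  refine ⟨g, (ultrafilter_eq_of_subset fun t ht => ?_).symm⟩
  obtain ⟨c, hc, h1, h2⟩ := hA.dir s t hs ht
  obtain ⟨g', hg', e⟩ := hz ⟨c, hc⟩
  rw [← eq_of_mem_arrows (arrows_subset_of_natLE h1 hg') hg e]
  exact arrows_subset_of_natLE h2 hg'

theorem inv_ofArrow (hn : 0 < n) (g : CuntzGpd n) : inv (ofArrow hn g) = ofArrow hn (inv g) := by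
  refine ultrafilter_eq_of_subset ?_
  rintro _ ⟨s, hs, rfl⟩
  exact inv_mem_arrows hs

theorem comp_ofArrow (hn : 0 < n) {g h : CuntzGpd n} (e : d g = r h)
    (e' : d (ofArrow hn g) = r (ofArrow hn h)) :
    comp (ofArrow hn g) (ofArrow hn h) e' = ofArrow hn (comp g h e) := by
  refine ultrafilter_eq_of_subset ?_
  rintro x ⟨s, hs, t, ht, hx⟩
  exact arrows_subset_of_natLE hx (comp_mem_arrows e hs ht)

theorem d_ofArrow (hn : 0 < n) (g : CuntzGpd n) : d (ofArrow hn g) = ofArrow hn (d g) := by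
  refine ultrafilter_eq_of_subset ?_
  rintro x ⟨_, ⟨s, hs, rfl⟩, t, ht, hx⟩
  have h := comp_mem_arrows (d_inv g) (inv_mem_arrows hs) ht
  rw [inv_comp] at h
  exact arrows_subset_of_natLE hx h

theorem r_ofArrow (hn : 0 < n) (g : CuntzGpd n) : r (ofArrow hn g) = ofArrow hn (r g) := by
  rw [← d_inv, inv_ofArrow, d_ofArrow, d_inv]

theorem d_ofArrow_eq_r_ofArrow_iff (hn : 0 < n) (g h : CuntzGpd n) :
    d (ofArrow hn g) = r (ofArrow hn h) ↔ d g = r h := by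
  rw [d_ofArrow, r_ofArrow, (ofArrow_injective hn).eq_iff]

theorem continuous_ofArrow (hn : 0 < n) : Continuous (ofArrow (n := n) hn) := by
  refine continuous_generateFrom_iff.2 ?_
  rintro _ ⟨s, rfl⟩
  exact isOpen_arrows s

/-- The arrows of the Cuntz groupoid correspond bijectively to the ultrafilters of the Cuntz
inverse monoid. -/
noncomputable def arrowEquiv (hn : 0 < n) :
    CuntzGpd n ≃ UltrafilterGroupoid (CuntzInverseMonoid n) :=
  Equiv.ofBijective (ofArrow hn) ⟨ofArrow_injective hn, ofArrow_surjective hn⟩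

theorem continuous_arrowEquiv_symm (hn : 0 < n) : Continuous (arrowEquiv (n := n) hn).symm := by
  refine continuous_generateFrom_iff.2 ?_
  rintro _ ⟨x, y, V, hV, rfl⟩
  refine isOpen_of_forall_mem_exists fun A hA => ?_
  obtain ⟨g, rfl⟩ := (arrowEquiv hn).surjective A
  rw [Set.mem_preimage, Equiv.symm_apply_apply] at hA
  obtain ⟨s, hs, hsV⟩ := exists_arrows_subset_basicOpen hV hA
  refine ⟨s, hs, fun B hB => ?_⟩
  obtain ⟨g', rfl⟩ := (arrowEquiv hn).surjective B
  rw [Set.mem_preimage, Equiv.symm_apply_apply]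
  exact hsV hB

/-- The isomorphism of topological groupoids that sends an ultrafilter to the one arrow covered by
all its elements. -/
noncomputable def topGroupoidIso (hn : 0 < n) :
    TopGroupoidIso (UltrafilterGroupoid (CuntzInverseMonoid n)) (CuntzGpd n) where
  toEquiv := (arrowEquiv hn).symm
  continuous_toFun := continuous_arrowEquiv_symm hn
  continuous_invFun := continuous_ofArrow hn
  composable_iff A B := by
    obtain ⟨g, rfl⟩ := (arrowEquiv hn).surjective A
    obtain ⟨h, rfl⟩ := (arrowEquiv hn).surjective B
    simp only [Equiv.toFun_as_coe, Equiv.symm_apply_apply]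
    exact d_ofArrow_eq_r_ofArrow_iff hn g h
  map_comp A B e := by
    obtain ⟨g, rfl⟩ := (arrowEquiv hn).surjective A
    obtain ⟨h, rfl⟩ := (arrowEquiv hn).surjective B
    have e' : d g = r h := (d_ofArrow_eq_r_ofArrow_iff hn g h).1 e
    simp only [Equiv.toFun_as_coe, Equiv.symm_apply_apply]
    rw [Equiv.symm_apply_eq]
    exact comp_ofArrow hn e' e

end CuntzInverseMonoid

end CuntzGroupoid

theorem mainTheorem3 (n : ℕ) (hn : 2 ≤ n) :
    CuntzGroupoid.IsEtaleGroupoid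
      (CuntzGroupoid.UltrafilterGroupoid (CuntzGroupoid.CuntzInverseMonoid n)) ∧
    Nonempty (CuntzGroupoid.TopGroupoidIso
      (CuntzGroupoid.UltrafilterGroupoid (CuntzGroupoid.CuntzInverseMonoid n))
      (CuntzGroupoid.CuntzGpd n)) :=
  ⟨CuntzGroupoid.isEtaleGroupoid_ultrafilterGroupoid _,
    ⟨CuntzGroupoid.CuntzInverseMonoid.topGroupoidIso (by omega)⟩⟩
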